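/- **Setting.** Let $\mathcal X\subset\mathbb R^n$ be closed, convex and bounded, and let $\xi$ be a random element with values in a (measurable) set $\Xi$. Let $g_1,\hat g_1,g_2$ be real-valued functions $g_1(x,\xi)$, $\hat g_1(x,y,\xi)$, $g_2(x,\xi)$ such that $g_1(\cdot,\xi)$ is continuously differentiable (possibly nonconvex), $g_2(\cdot,\xi)$ is convex and continuous on $\mathcal X$ (possibly nonsmooth), and $g_1(x,\cdot)$, $g_2(x,\cdot)$ are measurable for $x\in\mathcal X$. Consider $$\min_{x\in\mathcal X}\ f(x),\qquad f(x)=\mathbb E_\xi\big[g_1(x,\xi)+g_2(x,\xi)\big].$$ For a function $h:D\to\mathbb R$ on a convex set $D\subseteq\mathbb R^n$, $x\in D$ and $d\in\mathbb R^n$, put $h'(x;d)=\liminf_{t\downarrow0}\frac{h(x+td)-h(x)}t\in[-\infty,+\infty]$, with $h'(x;d)=+\infty$ if $x+td\notin D$ for all $t>0$; $x\in D$ is a stationary point of $h$ if $h'(x;d)\ge0$ for all $d\in\mathbb R^n$. All derivatives below are taken with respect to $x$, and $\|\cdot\|$ is the Euclidean norm (and the induced operator norm on matrices). Write $\hat g(x,y,\xi)=\hat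 g_1(x,y,\xi)+g_2(x,\xi)$ for $x,y\in\mathcal X$. **Assumption A.** - (A1) $\hat g_1(y,y,\xi)=g_1(y,\xi)$ for all $y\in\mathcal X$, $\xi\in\Xi$. - (A2) There is an open set $\mathcal X'\supseteq\mathcal X$ such that $\hat g_1(x,y,\xi)\ge g_1(x,\xi)$ for all $x\in\mathcal X'$, $y\in\mathcal X$, $\xi\in\Xi$. - (A3) There is $\gamma>0$ such that for all $x,y\in\mathcal X$, $\xi\in\Xi$ and all $d$ with $x+d\in\mathcal X$, $$\hat g(x+d,y,\xi)-\hat g(x,y,\xi)\ \ge\ \hat g'(x,y,\xi;d)+\tfrac\gamma2\|d\|^2,$$ where $\hat g'(x,y,\xi;d)$ is the directional derivative of $\hat g(\cdot,y,\xi):\mathcal X\to\mathbb R$ at $x$. **Assumption B.** - (B1) $g_1(\cdot,\xi)$ and $\hat g_1(\cdot,y,\xi)$ are continuous on $\mathcal X$ for all $y\in\mathcal X$, $\xi\in\Xi$. - (B2) $\mathcal X$ is bounded. - (B3) $g_1(\cdot,\xi)$ and $\hat g_1(\cdot,y,\xi)$ are twice differentiable at the points of $\mathcal X$, and there is $K>0$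 such that $|g_1|$, $\|\nabla_xg_1\|$, $\|\nabla_x^2g_1\|$, $|\hat g_1|$, $\|\nabla_x\hat g_1\|$, $\|\nabla_x^2\hat g_1\|$ are all at most $K$ on $\mathcal X\times\mathcal X\times\Xi$. - (B4) $g_2(\cdot,\xi)$ is convex for every $\xi\in\Xi$. - (B5) There is $K'>0$ such that $|g_2(x,\xi)|\le K'$ and $|g_2'(x,\xi;d)|\le K'\|d\|$ for all $x\in\mathcal X$, $\xi\in\Xi$ and all $d$ with $x+d\in\mathcal X$. - (B6) There is $\bar g\in\mathbb R$ such that $|\hat g(x,y,\xi)|\le\bar g$ on $\mathcal X\times\mathcal X\times\Xi$. **Theorem.** Suppose that Assumptions A and B hold. Let $\xi^1,\xi^2,\dots$ be independent copies of $\xi$, and let $x^0,x^1,x^2,\dots$ be the iterates of the stochastic successive upper-bound minimization (SSUM) algorithm: $x^0\in\mathcal X$ and, for $r\ge1$, $$x^r\in\arg\min_{x\in\mathcal X}\ \frac1r\sum_{i=1}^r\big(\hat g_1(x,x^{i-1},\xi^i)+g_2(x,\xi^i)\big).$$ Then the set $\mathcal X^*$ of stationary points of $f:\mathcal X\to\mathbb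 R$ is non-empty and $$\lim_{r\to\infty}d(x^r,\mathcal X^*)=0\quad\text{almost surely,}\qquad d(x,S)=\inf_{s\in S}\|x-s\|.$$ -/

import Mathlib

open Filter Topology MeasureTheory ProbabilityTheory

noncomputable section

namespace SSUM

open Classical in
/-- The lower directional derivative `h'(x; d) = liminf_{t ↓ 0} (h (x + t d) - h x) / t` of a
function `h : D → ℝ` on a convex set `D`, an extended real number. It is `+∞` if `x + t d ∉ D` for
all `t > 0`. (The function is total in Lean; for convex `D`, `x ∈ D` and `x + t d ∈ D` for some
`t > 0`, only the values of `h` on `D` enter the lower limit.) -/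
def dirDeriv {n : ℕ} (D : Set (EuclideanSpace ℝ (Fin n))) (h : EuclideanSpace ℝ (Fin n) → ℝ)
    (x d : EuclideanSpace ℝ (Fin n)) : EReal :=
  if ∃ t : ℝ, 0 < t ∧ x + t • d ∈ D then
    liminf (fun t : ℝ => (((h (x + t • d) - h x) / t : ℝ) : EReal)) (𝓝[>] (0 : ℝ))
  else ⊤

/-- The set of stationary points of `h : D → ℝ`: the points `x` of `D` with `h'(x; d) ≥ 0` for
all directions `d`. -/
def stationaryPoints {n : ℕ} (D : Set (EuclideanSpace ℝ (Fin n)))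
    (h : EuclideanSpace ℝ (Fin n) → ℝ) : Set (EuclideanSpace ℝ (Fin n)) :=
  {x | x ∈ D ∧ ∀ d : EuclideanSpace ℝ (Fin n), 0 ≤ dirDeriv D h x d}

/-- `h` is twice (Fréchet) differentiable at `x`: it is differentiable near `x`, and its derivative
is differentiable at `x`. -/
def TwiceDifferentiableAt {n : ℕ} (h : EuclideanSpace ℝ (Fin n) → ℝ)
    (x : EuclideanSpace ℝ (Fin n)) : Prop :=
  (∀ᶠ z in 𝓝 x, DifferentiableAt ℝ h z) ∧ DifferentiableAt ℝ (fderiv ℝ h) x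

/-- The objective `f x = E[g₁ (x, ξ) + g₂ (x, ξ)]`, where `ξ` has law `P`. -/
def objective {n : ℕ} {Ξ : Type*} [MeasurableSpace Ξ] (P : Measure Ξ)
    (g₁ g₂ : EuclideanSpace ℝ (Fin n) → Ξ → ℝ) (x : EuclideanSpace ℝ (Fin n)) : ℝ :=
  ∫ z, (g₁ x z + g₂ x z) ∂P

/-- The standing setting: `X` is closed and convex, `g₁` is continuously differentiable in `x`,
`g₂` is convex and continuous in `x`, and both are measurable in the random parameter. -/
structure Setting {n : ℕ} {Ξ : Type*} [MeasurableSpace Ξ] (X : Set (EuclideanSpace ℝ (Fin n)))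
    (g₁ g₂ : EuclideanSpace ℝ (Fin n) → Ξ → ℝ) : Prop where
  isClosed : IsClosed X
  convex : Convex ℝ X
  contDiffOn_g₁ : ∀ z : Ξ, ContDiffOn ℝ 1 (fun x => g₁ x z) X
  convexOn_g₂ : ∀ z : Ξ, ConvexOn ℝ X (fun x => g₂ x z)
  continuousOn_g₂ : ∀ z : Ξ, ContinuousOn (fun x => g₂ x z) X
  measurable_g₁ : ∀ x ∈ X, Measurable (g₁ x)
  measurable_g₂ : ∀ x ∈ X, Measurable (g₂ x)

/-- The assumptions on the surrogate `ghat₁ x y z` of `g₁ x z` around `y`: it is exact at `x = y`,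
an upper bound on an open set containing `X`, and `ghat₁ + g₂` is uniformly strongly convex in `x`
on its domain `X`. -/
structure SurrogateAssumptions {n : ℕ} {Ξ : Type*} (X : Set (EuclideanSpace ℝ (Fin n)))
    (g₁ g₂ : EuclideanSpace ℝ (Fin n) → Ξ → ℝ)
    (ghat₁ : EuclideanSpace ℝ (Fin n) → EuclideanSpace ℝ (Fin n) → Ξ → ℝ) : Prop where
  tight : ∀ y ∈ X, ∀ z : Ξ, ghat₁ y y z = g₁ y z
  upper_bound : ∃ X' : Set (EuclideanSpace ℝ (Fin n)), IsOpen X' ∧ X ⊆ X' ∧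
    ∀ x ∈ X', ∀ y ∈ X, ∀ z : Ξ, g₁ x z ≤ ghat₁ x y z
  strongly_convex : ∃ γ : ℝ, 0 < γ ∧ ∀ x ∈ X, ∀ y ∈ X, ∀ z : Ξ,
    ∀ d : EuclideanSpace ℝ (Fin n), x + d ∈ X →
      dirDeriv X (fun u => ghat₁ u y z + g₂ u z) x d + ((γ / 2 * ‖d‖ ^ 2 : ℝ) : EReal)
        ≤ (((ghat₁ (x + d) y z + g₂ (x + d) z) - (ghat₁ x y z + g₂ x z) : ℝ) : EReal)

/-- The regularity and boundedness assumptions. All derivatives are in the variable `x`; the first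
derivative carries the norm of the gradient, the second one the operator norm of the Hessian. -/
structure BoundednessAssumptions {n : ℕ} {Ξ : Type*} (X : Set (EuclideanSpace ℝ (Fin n)))
    (g₁ g₂ : EuclideanSpace ℝ (Fin n) → Ξ → ℝ)
    (ghat₁ : EuclideanSpace ℝ (Fin n) → EuclideanSpace ℝ (Fin n) → Ξ → ℝ) : Prop where
  continuousOn_g₁ : ∀ z : Ξ, ContinuousOn (fun x => g₁ x z) X
  continuousOn_ghat₁ : ∀ y ∈ X, ∀ z : Ξ, ContinuousOn (fun x => ghat₁ x y z) X
  isBounded : Bornology.IsBounded X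
  twiceDifferentiable_g₁ : ∀ x ∈ X, ∀ z : Ξ, TwiceDifferentiableAt (fun u => g₁ u z) x
  twiceDifferentiable_ghat₁ : ∀ x ∈ X, ∀ y ∈ X, ∀ z : Ξ,
    TwiceDifferentiableAt (fun u => ghat₁ u y z) x
  bound_smooth : ∃ K : ℝ, 0 < K ∧ ∀ x ∈ X, ∀ y ∈ X, ∀ z : Ξ,
    |g₁ x z| ≤ K ∧ ‖fderiv ℝ (fun u => g₁ u z) x‖ ≤ K ∧
    ‖fderiv ℝ (fderiv ℝ (fun u => g₁ u z)) x‖ ≤ K ∧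
    |ghat₁ x y z| ≤ K ∧ ‖fderiv ℝ (fun u => ghat₁ u y z) x‖ ≤ K ∧
    ‖fderiv ℝ (fderiv ℝ (fun u => ghat₁ u y z)) x‖ ≤ K
  bound_nonsmooth : ∃ K' : ℝ, 0 < K' ∧ ∀ x ∈ X, ∀ z : Ξ, |g₂ x z| ≤ K' ∧
    ∀ d : EuclideanSpace ℝ (Fin n), x + d ∈ X →
      ((-(K' * ‖d‖) : ℝ) : EReal) ≤ dirDeriv X (fun u => g₂ u z) x d ∧
      dirDeriv X (fun u => g₂ u z) x d ≤ ((K' * ‖d‖ : ℝ) : EReal)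
  bound_surrogate : ∃ gbar : ℝ, ∀ x ∈ X, ∀ y ∈ X, ∀ z : Ξ, |ghat₁ x y z + g₂ x z| ≤ gbar

/-- `x 0, x 1, …` are iterates of the algorithm for the sample sequence `ξ`, where `ξ i` is the
`(i + 1)`-st sample: `x 0` is feasible and, for `r ≥ 1`, `x r` minimizes over `X` the function
`u ↦ (1 / r) ∑_{i = 1}^{r} (ghat₁ (u, x_{i-1}, ξ^i) + g₂ (u, ξ^i))`. -/
def IsIterates {n : ℕ} {Ξ : Type*} (X : Set (EuclideanSpace ℝ (Fin n)))
    (g₂ : EuclideanSpace ℝ (Fin n) → Ξ → ℝ)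
    (ghat₁ : EuclideanSpace ℝ (Fin n) → EuclideanSpace ℝ (Fin n) → Ξ → ℝ)
    (ξ : ℕ → Ξ) (x : ℕ → EuclideanSpace ℝ (Fin n)) : Prop :=
  x 0 ∈ X ∧ ∀ r : ℕ, 1 ≤ r → x r ∈ X ∧
    IsMinOn (fun u => (1 / (r : ℝ)) *
      ∑ i ∈ Finset.range r, (ghat₁ u (x i) (ξ i) + g₂ u (ξ i))) X (x r)

end SSUM

end

namespace SSUM

/-! Let W_r be the minimal value of the sum of the first r surrogates. Strong convexity puts
consecutive minimizers O(1/r) apart. A surrogate touches its sample from above and Hessians are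
bounded, so the surrogates added shortly after time r exceed their samples at x_r only by squares of
small distances. Hence W_r / r is nonincreasing up to small errors (`average_add_le`) and converges.
Comparing W_r with W_{r+m}, m a small fraction of r, shows that f(x_r) has the same limit
(`tendsto_average_sub`). Quadratic growth then forces ‖x_R - x_i‖² to be small on average over i < R
(`eventually_sum_norm_sub_sq_le`). So the surrogates around the old x_i act almost like surrogates
around x_R, and x_R minimizes f up to 2C‖u - x_R‖² + o(1) (`eventually_le_add`). A quadratic term
does not affect first-order conditions, so limit points are stationary, and compactness concludes.

Randomness enters only through a uniform law of large numbers along r = j^5 with deviation O(j^3)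
(`ae_eventually_abs_sum_le`). The Hoeffding bound exp(-cj) beats the polynomial size of a net of X.
The relative deviation j^(-2) is summable, and so is the cube of the relative gap O(1/j) between
consecutive fifth powers. -/

/-- The accumulated deviation of the samples `G i` from `f` at the point `u`. -/
def noise {E : Type*} (f : E → ℝ) (G : ℕ → E → ℝ) (r : ℕ) (u : E) : ℝ :=
  ∑ i ∈ Finset.range r, (G i u - f u)

/-- The sum of the first `r` surrogates at the `r`-th iterate. -/
def surrogateValue {E : Type*} (H : ℕ → E → ℝ) (x : ℕ → E) (r : ℕ) : ℝ :=
  ∑ i ∈ Finset.range r, H i (x r)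

/-- A realization of the algorithm for which the sample averages of `G` converge to `f` at a
polynomial rate along the fifth powers: `H i` is a surrogate of `G i` around `x i`, and `x r`
minimizes `∑ i < r, H i` with quadratic growth. -/
structure IsMajorizationRun {E : Type*} [NormedAddCommGroup E] (X : Set E) (f : E → ℝ)
    (G H : ℕ → E → ℝ) (x : ℕ → E) (M L γ C D C₀ : ℝ) : Prop where
  L_nonneg : 0 ≤ L
  M_nonneg : 0 ≤ M
  γ_pos : 0 < γ
  C_nonneg : 0 ≤ C
  C₀_nonneg : 0 ≤ C₀
  mem : ∀ r, x r ∈ X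
  diam : ∀ u ∈ X, ∀ w ∈ X, ‖u - w‖ ≤ D
  bound_G : ∀ i, ∀ u ∈ X, |G i u| ≤ M
  bound_f : ∀ u ∈ X, |f u| ≤ M
  lipschitz : ∀ i, ∀ u ∈ X, ∀ w ∈ X, |H i u - H i w| ≤ L * ‖u - w‖
  le_surrogate : ∀ i, ∀ u ∈ X, G i u ≤ H i u
  surrogate_le : ∀ i, ∀ u ∈ X, H i u ≤ G i u + C * ‖u - x i‖ ^ 2
  growth : ∀ r, ∀ u ∈ X, surrogateValue H x r + r * (γ / 2) * ‖u - x r‖ ^ 2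
    ≤ ∑ i ∈ Finset.range r, H i u
  rate : ∀ᶠ j : ℕ in atTop, ∀ u ∈ X, |noise f G (j ^ 5) u| ≤ C₀ * (j : ℝ) ^ 3

/-! ### Fifth powers and almost monotone sequences. -/

lemma exists_pow_five_le {J R : ℕ} (h : J ^ 5 ≤ R) :
    ∃ j, J ≤ j ∧ j ^ 5 ≤ R ∧ R < (j + 1) ^ 5 := by
  have hP : J ≤ R := (Nat.le_self_pow (by norm_num) J).trans h
  refine ⟨Nat.findGreatest (fun j => j ^ 5 ≤ R) R, Nat.le_findGreatest hP h,
    Nat.findGreatest_spec (P := fun j => j ^ 5 ≤ R) hP h, ?_⟩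
  by_contra hc
  push Not at hc
  have h1 : Nat.findGreatest (fun j => j ^ 5 ≤ R) R + 1 ≤ R :=
    (Nat.le_self_pow (by norm_num) _).trans hc
  have := Nat.le_findGreatest (P := fun j => j ^ 5 ≤ R) h1 hc
  omega

/-- The constant is the sum 5 + 10 + 10 + 5 + 1 of the lower binomial coefficients. -/
lemma succ_pow_five_le {j : ℕ} (hj : 1 ≤ j) : ((j : ℝ) + 1) ^ 5 ≤ (j : ℝ) ^ 5 + 31 * (j : ℝ) ^ 4 := by
  have h : (1 : ℝ) ≤ j := by exact_mod_cast hj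
  have h1 : (j : ℝ) ^ 1 ≤ (j : ℝ) ^ 4 := pow_le_pow_right₀ h (by norm_num)
  have h2 : (j : ℝ) ^ 2 ≤ (j : ℝ) ^ 4 := pow_le_pow_right₀ h (by norm_num)
  have h3 : (j : ℝ) ^ 3 ≤ (j : ℝ) ^ 4 := pow_le_pow_right₀ h (by norm_num)
  have h4 : (1 : ℝ) ≤ (j : ℝ) ^ 4 := one_le_pow₀ h
  nlinarith

/-- A real sequence that is bounded below and whose increments are bounded above by a summable
sequence converges. -/
lemma exists_tendsto_of_le_add_summable {a b : ℕ → ℝ} {m : ℝ} (hb : Summable b)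
    (hm : ∀ j, m ≤ a j) (h : ∀ j, a (j + 1) ≤ a j + b j) : ∃ v, Tendsto a atTop (𝓝 v) := by
  have hs := hb.hasSum.tendsto_sum_nat
  have hanti : Antitone fun j => a j - ∑ i ∈ Finset.range j, b i := by
    refine antitone_nat_of_succ_le fun j => ?_
    rw [Finset.sum_range_succ]
    linarith [h j]
  obtain ⟨U, hU⟩ := hs.bddAbove_range
  have hbdd : BddBelow (Set.range fun j => a j - ∑ i ∈ Finset.range j, b i) := by
    refine ⟨m - U, ?_⟩
    rintro _ ⟨j, rfl⟩
    have := hU ⟨j, rfl⟩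
    simp only at this ⊢
    linarith [hm j]
  refine ⟨_, ((tendsto_atTop_ciInf hanti hbdd).add hs).congr fun j => ?_⟩
  ring

/-! ### Deterministic analysis of a run. -/

namespace IsMajorizationRun

variable {E : Type*} [NormedAddCommGroup E] {X : Set E} {f : E → ℝ} {G H : ℕ → E → ℝ}
  {x : ℕ → E} {M L γ C D C₀ : ℝ}

/-- Each of the two consecutive minimizers is a competitor in the other's problem. Adding the two
growth inequalities cancels all common surrogates and leaves a difference of H_r alone, which is
Lipschitz; a quadratic is thus bounded by a linear term. -/
lemma norm_step_le (h : IsMajorizationRun X f G H x M L γ C D C₀) {r : ℕ} (hr : 1 ≤ r) :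
    ‖x (r + 1) - x r‖ ≤ 2 * L / γ / r := by
  have hr' : (0 : ℝ) < r := by exact_mod_cast hr
  have h1 := h.growth r (x (r + 1)) (h.mem _)
  have h2 := h.growth (r + 1) (x r) (h.mem _)
  have h3 := (abs_le.1 (h.lipschitz r (x (r + 1)) (h.mem _) (x r) (h.mem _))).1
  have hγ := h.γ_pos
  have h4 : 0 ≤ ((r + 1 : ℕ) : ℝ) * (γ / 2) * ‖x r - x (r + 1)‖ ^ 2 := by positivity
  unfold surrogateValue at h1 h2
  rw [Finset.sum_range_succ, Finset.sum_range_succ] at h2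
  have h5 : r * (γ / 2) * ‖x (r + 1) - x r‖ ^ 2 ≤ L * ‖x (r + 1) - x r‖ := by linarith
  rcases (norm_nonneg (x (r + 1) - x r)).eq_or_lt with h0 | h0
  · rw [← h0]; have := h.L_nonneg; positivity
  · have h6 : r * (γ / 2) * ‖x (r + 1) - x r‖ ≤ L := by
      refine le_of_mul_le_mul_right ?_ h0
      calc _ = r * (γ / 2) * ‖x (r + 1) - x r‖ ^ 2 := by ring
        _ ≤ _ := h5
    rw [div_div, le_div_iff₀ (by positivity)]
    linarith

lemma norm_sub_le (h : IsMajorizationRun X f G H x M L γ C D C₀) {r : ℕ} (hr : 1 ≤ r) (k : ℕ) :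
    ‖x r - x (r + k)‖ ≤ k * (2 * L / γ / r) := by
  have hr' : (0 : ℝ) < r := by exact_mod_cast hr
  have hL := h.L_nonneg
  have hγ := h.γ_pos
  induction k with
  | zero => simp
  | succ k ih =>
    have h1 := h.norm_step_le (r := r + k) (by omega)
    have h2 : 2 * L / γ / ((r + k : ℕ) : ℝ) ≤ 2 * L / γ / r := by
      push_cast
      gcongr
      linarith [Nat.cast_nonneg (α := ℝ) k]
    have h3 : x r - x (r + (k + 1)) = (x r - x (r + k)) - (x (r + k + 1) - x (r + k)) := by
      rw [← add_assoc]; abel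
    rw [h3]
    refine (_root_.norm_sub_le _ _).trans ?_
    push_cast
    linarith

/-- The point x_r is a competitor in problem r + m. Each of the m new surrogates exceeds its sample
there by at most C times the squared drift, and the drift is at most m (2L/γ) / r. -/
lemma surrogateValue_add_le (h : IsMajorizationRun X f G H x M L γ C D C₀) {r : ℕ} (hr : 1 ≤ r)
    (m : ℕ) :
    surrogateValue H x (r + m) ≤ surrogateValue H x r + m * f (x r)
      + (noise f G (r + m) (x r) - noise f G r (x r)) + C * (2 * L / γ) ^ 2 * (m ^ 3 / r ^ 2) := by
  have hr' : (0 : ℝ) < r := by exact_mod_cast hr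
  have hC := h.C_nonneg
  have hγ := h.γ_pos
  have h1 := h.growth (r + m) (x r) (h.mem _)
  have h2 : 0 ≤ ((r + m : ℕ) : ℝ) * (γ / 2) * ‖x r - x (r + m)‖ ^ 2 := by positivity
  rw [Finset.sum_range_add] at h1
  have h3 : ∑ i ∈ Finset.range m, H (r + i) (x r)
      ≤ ∑ i ∈ Finset.range m,
        ((G (r + i) (x r) - f (x r)) + (f (x r) + C * (m * (2 * L / γ / r)) ^ 2)) := by
    refine Finset.sum_le_sum fun i hi => ?_
    have h4 := h.surrogate_le (r + i) (x r) (h.mem _)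
    have h5 : ‖x r - x (r + i)‖ ≤ m * (2 * L / γ / r) := by
      refine (h.norm_sub_le hr i).trans ?_
      have := h.L_nonneg
      have : (i : ℝ) ≤ m := by exact_mod_cast (Finset.mem_range.1 hi).le
      gcongr
    have h6 : C * ‖x r - x (r + i)‖ ^ 2 ≤ C * (m * (2 * L / γ / r)) ^ 2 := by gcongr
    linarith
  rw [Finset.sum_add_distrib, Finset.sum_const, Finset.card_range, nsmul_eq_mul] at h3
  have h7 : noise f G (r + m) (x r) - noise f G r (x r)
      = ∑ i ∈ Finset.range m, (G (r + i) (x r) - f (x r)) := by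
    unfold noise
    rw [Finset.sum_range_add]; ring
  have h8 : (m : ℝ) * (C * (m * (2 * L / γ / r)) ^ 2)
      = C * (2 * L / γ) ^ 2 * (m ^ 3 / r ^ 2) := by
    field_simp
  rw [h7]
  unfold surrogateValue at h1 ⊢
  linarith

lemma noise_add_le_surrogateValue (h : IsMajorizationRun X f G H x M L γ C D C₀) (r : ℕ) :
    noise f G r (x r) + r * f (x r) ≤ surrogateValue H x r := by
  unfold noise surrogateValue
  rw [Finset.sum_sub_distrib, Finset.sum_const, Finset.card_range, nsmul_eq_mul]
  have := Finset.sum_le_sum fun i (_ : i ∈ Finset.range r) => h.le_surrogate i (x r) (h.mem r)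
  linarith

/-- In the previous bound, f(x_r) is at most the current average of the surrogates plus noise,
because surrogates dominate samples. The error is cubic in m / r, which makes it summable along
fifth powers. -/
lemma average_add_le (h : IsMajorizationRun X f G H x M L γ C D C₀) {r : ℕ} (hr : 1 ≤ r)
    (m : ℕ) :
    surrogateValue H x (r + m) / (r + m : ℕ) ≤ surrogateValue H x r / r
      + |noise f G (r + m) (x r)| / (r + m : ℕ) + |noise f G r (x r)| / r
      + C * (2 * L / γ) ^ 2 * (m / r) ^ 3 := by
  have hr' : (0 : ℝ) < r := by exact_mod_cast hr
  have hC := h.C_nonneg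
  have h1 := h.surrogateValue_add_le hr m
  have h2 := h.noise_add_le_surrogateValue r
  have hm : (0 : ℝ) ≤ m := Nat.cast_nonneg m
  have h3 : f (x r) ≤ surrogateValue H x r / r - noise f G r (x r) / r := by
    rw [← sub_div, le_div_iff₀ hr']; linarith
  have h4 := mul_le_mul_of_nonneg_left h3 hm
  have h5 : (m : ℝ) ^ 3 / r ^ 2 ≤ (m / r) ^ 3 * (r + m) := by
    calc (m : ℝ) ^ 3 / r ^ 2 = (m / r) ^ 3 * r := by field_simp
      _ ≤ _ := by gcongr; linarith
  have h6 : C * (2 * L / γ) ^ 2 * ((m : ℝ) ^ 3 / r ^ 2)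
      ≤ C * (2 * L / γ) ^ 2 * ((m / r) ^ 3 * (r + m)) := by gcongr
  have h7 := le_abs_self (noise f G (r + m) (x r))
  have h8 := neg_abs_le (noise f G r (x r))
  have h9 : (0 : ℝ) < ((r + m : ℕ) : ℝ) := by push_cast; linarith
  have h10 : -(noise f G r (x r) / r) ≤ |noise f G r (x r)| / r := by
    rw [← neg_div]; gcongr; exact neg_le_abs _
  have h11 := mul_le_mul_of_nonneg_left h10 h9.le
  rw [div_le_iff₀ h9, add_mul, add_mul, add_mul, div_mul_cancel₀ _ h9.ne']
  have h12 : surrogateValue H x r = surrogateValue H x r / r * r := by field_simp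
  have h13 : noise f G r (x r) = noise f G r (x r) / r * r := by field_simp
  push_cast at h11 ⊢
  nlinarith

lemma abs_noise_add_le (h : IsMajorizationRun X f G H x M L γ C D C₀) (r m : ℕ) {u : E}
    (hu : u ∈ X) : |noise f G (r + m) u| ≤ |noise f G r u| + m * (2 * M) := by
  have h1 : noise f G (r + m) u = noise f G r u + ∑ i ∈ Finset.range m, (G (r + i) u - f u) := by
    unfold noise
    rw [Finset.sum_range_add]
  have h2 : |∑ i ∈ Finset.range m, (G (r + i) u - f u)| ≤ m * (2 * M) := by
    refine (Finset.abs_sum_le_sum_abs _ _).trans ?_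
    refine (Finset.sum_le_card_nsmul _ _ (2 * M) fun i _ => ?_).trans (by simp)
    refine (abs_sub _ _).trans ?_
    linarith [h.bound_G (r + i) u hu, h.bound_f u hu]
  rw [h1]
  exact (abs_add_le _ _).trans (by linarith)

/-- Between consecutive fifth powers at most 31 j^4 samples are added, each changing the noise by at
most 2M. This is o(j^5), so the rate along fifth powers yields a uniform law for all R. -/
lemma eventually_abs_noise_le (h : IsMajorizationRun X f G H x M L γ C D C₀) {ε : ℝ}
    (hε : 0 < ε) : ∀ᶠ R : ℕ in atTop, ∀ u ∈ X, |noise f G R u| ≤ ε * R := by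
  have hM := h.M_nonneg
  have hC := h.C₀_nonneg
  obtain ⟨J₁, hJ₁⟩ := eventually_atTop.1 h.rate
  obtain ⟨J₂, hJ₂⟩ := exists_nat_gt ((C₀ + 62 * M) / ε)
  refine eventually_atTop.2 ⟨(max (max J₁ J₂) 1) ^ 5, fun R hR u hu => ?_⟩
  obtain ⟨j, hj, hjR, hRj⟩ := exists_pow_five_le hR
  have hj1 : 1 ≤ j := (le_max_right _ _).trans hj
  have hjJ₁ : J₁ ≤ j := (le_max_left _ _).trans ((le_max_left _ _).trans hj)
  have hjJ₂ : J₂ ≤ j := (le_max_right _ _).trans ((le_max_left _ _).trans hj)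
  obtain ⟨m, rfl⟩ := Nat.exists_eq_add_of_le hjR
  have hjr : (1 : ℝ) ≤ j := by exact_mod_cast hj1
  have hm : (m : ℝ) ≤ 31 * (j : ℝ) ^ 4 := by
    have : ((j : ℝ) ^ 5 + m) ≤ ((j : ℝ) + 1) ^ 5 := by exact_mod_cast hRj.le
    linarith [succ_pow_five_le hj1]
  have h1 := h.abs_noise_add_le (j ^ 5) m hu
  have h2 := hJ₁ j hjJ₁ u hu
  have h3 : (j : ℝ) ^ 3 ≤ (j : ℝ) ^ 4 := pow_le_pow_right₀ hjr (by norm_num)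
  have h4 : C₀ + 62 * M ≤ ε * j := by
    rw [div_lt_iff₀ hε] at hJ₂
    have : (J₂ : ℝ) ≤ j := by exact_mod_cast hjJ₂
    nlinarith
  have h5 : (C₀ + 62 * M) * (j : ℝ) ^ 4 ≤ ε * j * (j : ℝ) ^ 4 := by gcongr
  have h6 : m * (2 * M) ≤ 31 * (j : ℝ) ^ 4 * (2 * M) := by gcongr
  have h7 : C₀ * (j : ℝ) ^ 3 ≤ C₀ * (j : ℝ) ^ 4 := by gcongr
  have h8 : 0 ≤ ε * m := by positivity
  push_cast
  nlinarith

lemma tendsto_average_pow_five (h : IsMajorizationRun X f G H x M L γ C D C₀) :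
    ∃ v, Tendsto (fun j : ℕ => surrogateValue H x (j ^ 5) / (j ^ 5 : ℕ)) atTop (𝓝 v) := by
  have hM := h.M_nonneg
  have hC := h.C_nonneg
  have hC₀ := h.C₀_nonneg
  obtain ⟨J, hJ⟩ := eventually_atTop.1 h.rate
  have key : ∀ j, J + 1 ≤ j → ∀ u ∈ X, |noise f G (j ^ 5) u| / (j ^ 5 : ℕ) ≤ C₀ / (j : ℝ) ^ 2 := by
    intro j hj u hu
    have hj0 : (0 : ℝ) < j := by exact_mod_cast (by omega : 0 < j)
    push_cast
    rw [div_le_div_iff₀ (by positivity) (by positivity)]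
    have := mul_le_mul_of_nonneg_right (hJ j (by omega) u hu) (by positivity : 0 ≤ (j : ℝ) ^ 2)
    calc _ ≤ _ := this
      _ = _ := by ring
  -- The shift by J + 1 starts the sequence past the threshold of the rate and away from j = 0.
  have hb : Summable fun j : ℕ =>
      (2 * C₀ + C * (2 * L / γ) ^ 2 * 31 ^ 3) * (1 / ((j + (J + 1) : ℕ) : ℝ) ^ 2) :=
    ((summable_nat_add_iff (J + 1)).2
      (Real.summable_one_div_nat_pow.2 (by norm_num : 1 < 2))).mul_left _
  have := exists_tendsto_of_le_add_summable
    (a := fun j : ℕ => surrogateValue H x ((j + (J + 1)) ^ 5) / ((j + (J + 1)) ^ 5 : ℕ))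
    (m := -M - C₀) hb ?_ ?_
  · obtain ⟨v, hv⟩ := this
    exact ⟨v, (tendsto_add_atTop_iff_nat (f := fun j : ℕ =>
      surrogateValue H x (j ^ 5) / (j ^ 5 : ℕ)) (J + 1)).1 hv⟩
  · intro j
    set k := j + (J + 1) with hk
    have hk1 : (1 : ℝ) ≤ k := by exact_mod_cast (by omega : 1 ≤ k)
    have h1 := h.noise_add_le_surrogateValue (k ^ 5)
    have h2 := key k (by omega) _ (h.mem (k ^ 5))
    have h3 : C₀ / (k : ℝ) ^ 2 ≤ C₀ := div_le_self hC₀ (one_le_pow₀ hk1)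
    have h4 := (abs_le.1 (h.bound_f _ (h.mem (k ^ 5)))).1
    have h5 : (0 : ℝ) < ((k ^ 5 : ℕ) : ℝ) := by push_cast; positivity
    have h6 := h2.trans h3
    rw [div_le_iff₀ h5] at h6
    have h7 := neg_abs_le (noise f G (k ^ 5) (x (k ^ 5)))
    rw [le_div_iff₀ h5]
    nlinarith
  · intro j
    set k := j + (J + 1) with hk
    have hk1 : (1 : ℝ) ≤ k := by exact_mod_cast (by omega : 1 ≤ k)
    have hk0 : (0 : ℝ) < k := by linarith
    have e1 : j + 1 + (J + 1) = k + 1 := by omega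
    simp only [e1]
    obtain ⟨m, hm⟩ := Nat.exists_eq_add_of_le (Nat.pow_le_pow_left (Nat.le_succ k) 5)
    have hm' : (m : ℝ) ≤ 31 * (k : ℝ) ^ 4 := by
      have : ((k : ℝ) + 1) ^ 5 = (k : ℝ) ^ 5 + m := by exact_mod_cast hm
      linarith [succ_pow_five_le (j := k) (by omega)]
    have h1 := h.average_add_le (r := k ^ 5) (Nat.one_le_pow _ _ (by omega)) m
    have h2 := key k (by omega) _ (h.mem (k ^ 5))
    have h3 := key (k + 1) (by omega) _ (h.mem (k ^ 5))
    have h4 : C₀ / ((k + 1 : ℕ) : ℝ) ^ 2 ≤ C₀ / (k : ℝ) ^ 2 := by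
      push_cast
      gcongr
      linarith
    have h5 : C * (2 * L / γ) ^ 2 * (m / ((k ^ 5 : ℕ) : ℝ)) ^ 3
        ≤ C * (2 * L / γ) ^ 2 * (31 ^ 3 * (1 / (k : ℝ) ^ 2)) := by
      gcongr
      have : (m : ℝ) / ((k ^ 5 : ℕ) : ℝ) ≤ 31 / k := by
        push_cast
        rw [div_le_div_iff₀ (by positivity) hk0]
        calc _ ≤ 31 * (k : ℝ) ^ 4 * k := by gcongr
          _ = _ := by ring
      calc _ ≤ (31 / (k : ℝ)) ^ 3 := by gcongr
        _ = 31 ^ 3 * (1 / (k : ℝ) ^ 3) := by ring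
        _ ≤ _ := by
          (gcongr; norm_num)
    rw [← hm] at h1
    have h6 : C₀ / (k : ℝ) ^ 2 = C₀ * (1 / (k : ℝ) ^ 2) := by ring
    have h3' := h3.trans h4
    rw [Nat.succ_eq_add_one] at h1
    rw [h6] at h2 h3'
    linarith

/-- Controls the rise of the average inside one block between fifth powers, where m / r ≤ 31 / j. -/
lemma eventually_average_add_le (h : IsMajorizationRun X f G H x M L γ C D C₀) {η : ℝ}
    (hη : 0 < η) : ∀ᶠ j : ℕ in atTop, ∀ r m : ℕ, j ^ 5 ≤ r → (m : ℝ) ≤ 31 * (j : ℝ) ^ 4 →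
      surrogateValue H x (r + m) / (r + m : ℕ) ≤ surrogateValue H x r / r + η := by
  have hC := h.C_nonneg
  obtain ⟨N, hN⟩ := eventually_atTop.1 (h.eventually_abs_noise_le (by positivity : 0 < η / 3))
  have hlim : Tendsto (fun j : ℕ => C * (2 * L / γ) ^ 2 * (31 / (j : ℝ)) ^ 3) atTop (𝓝 0) := by
    have := ((tendsto_const_div_atTop_nhds_zero_nat (31 : ℝ)).pow 3).const_mul
      (C * (2 * L / γ) ^ 2)
    simpa using this
  filter_upwards [hlim.eventually (gt_mem_nhds (by positivity : 0 < η / 3)),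
    eventually_ge_atTop (N + 1)] with j hj hjN r m hr hm
  have hj0 : (0 : ℝ) < j := by exact_mod_cast (by omega : 0 < j)
  have hjr : j ≤ r := (Nat.le_self_pow (by norm_num) j).trans hr
  have hr0 : (0 : ℝ) < r := by exact_mod_cast (by omega : 0 < r)
  have h1 := h.average_add_le (by omega : 1 ≤ r) m
  have h2 : |noise f G (r + m) (x r)| / (r + m : ℕ) ≤ η / 3 := by
    rw [div_le_iff₀ (by exact_mod_cast (by omega : 0 < r + m))]
    exact hN _ (by omega) _ (h.mem r)
  have h3 : |noise f G r (x r)| / r ≤ η / 3 := by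
    rw [div_le_iff₀ hr0]
    exact hN _ (by omega) _ (h.mem r)
  have h4 : (m : ℝ) / r ≤ 31 / j := by
    have : (j : ℝ) ^ 5 ≤ r := by exact_mod_cast hr
    calc (m : ℝ) / r ≤ 31 * (j : ℝ) ^ 4 / (j : ℝ) ^ 5 := by gcongr
      _ = 31 / j := by field_simp
  have h5 : C * (2 * L / γ) ^ 2 * (m / r) ^ 3 ≤ C * (2 * L / γ) ^ 2 * (31 / (j : ℝ)) ^ 3 := by
    gcongr
  linarith

/-- The average rises by at most ε / 2 from j^5 to R and again from R to (j + 1)^5, so its value at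
R is squeezed between those at the two ends. -/
lemma exists_tendsto_average (h : IsMajorizationRun X f G H x M L γ C D C₀) :
    ∃ v, Tendsto (fun r : ℕ => surrogateValue H x r / r) atTop (𝓝 v) := by
  obtain ⟨v, hv⟩ := h.tendsto_average_pow_five
  refine ⟨v, Metric.tendsto_atTop.2 fun ε hε => ?_⟩
  obtain ⟨J, hJ⟩ := eventually_atTop.1 ((h.eventually_average_add_le (half_pos hε)).and
    ((Metric.tendsto_nhds.1 hv (ε / 2) (half_pos hε)).and (eventually_ge_atTop 1)))
  refine ⟨J ^ 5, fun R hR => ?_⟩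
  obtain ⟨j, hj, hjR, hRj⟩ := exists_pow_five_le hR
  obtain ⟨h1, h2, h3⟩ := hJ j hj
  obtain ⟨-, h2', -⟩ := hJ (j + 1) (by omega)
  obtain ⟨m, rfl⟩ := Nat.exists_eq_add_of_le hjR
  obtain ⟨m', hm'⟩ := Nat.exists_eq_add_of_le hRj.le
  have hs := succ_pow_five_le h3
  have e : ((j : ℝ) + 1) ^ 5 = (j : ℝ) ^ 5 + m + m' := by exact_mod_cast hm'
  have h4 := h1 (j ^ 5) m le_rfl (by linarith [Nat.cast_nonneg (α := ℝ) m'])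
  have h5 := h1 (j ^ 5 + m) m' hjR (by linarith [Nat.cast_nonneg (α := ℝ) m])
  rw [← hm'] at h5
  rw [Real.dist_eq, abs_lt] at h2 h2' ⊢
  constructor <;> linarith

/-- That f(x_r) is not much above the average follows from domination of the samples. Conversely,
W_{r+m} - W_r is about m v, with v the limit of the averages, yet at most about m f(x_r); so f(x_r)
cannot be much below v. -/
lemma tendsto_average_sub (h : IsMajorizationRun X f G H x M L γ C D C₀) :
    Tendsto (fun r : ℕ => surrogateValue H x r / r - f (x r)) atTop (𝓝 0) := by
  obtain ⟨v, hv⟩ := h.exists_tendsto_average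
  have hC := h.C_nonneg
  refine Metric.tendsto_nhds.2 fun ε hε => ?_
  set K := C * (2 * L / γ) ^ 2 with hK
  have hK0 : 0 ≤ K := by positivity
  -- With m between ηr and 2ηr, the cubic error K m³ / r² is at most 4Kη² m, which must stay below m
  -- ε / 2.
  obtain ⟨η, hη0, hη1, hηK⟩ : ∃ η : ℝ, 0 < η ∧ η ≤ 1 / 2 ∧ 4 * K * η ^ 2 < ε / 2 := by
    refine ⟨min (1 / 2) (ε / (8 * (K + 1))), by positivity, min_le_left _ _, ?_⟩
    set η := min (1 / 2) (ε / (8 * (K + 1)))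
    have h1 : η ≤ 1 / 2 := min_le_left _ _
    have h2 : η ≤ ε / (8 * (K + 1)) := min_le_right _ _
    have h0 : 0 < η := by positivity
    rw [le_div_iff₀ (by positivity)] at h2
    nlinarith [mul_nonneg hK0 h0.le]
  -- The noise and convergence errors add up to 10δr, which is at most m ε / 2 because r ≤ m / η.
  set δ := ε * η / 20 with hδ
  have hδ0 : 0 < δ := by positivity
  obtain ⟨N, hN⟩ := eventually_atTop.1 ((h.eventually_abs_noise_le hδ0).and
    (Metric.tendsto_nhds.1 hv δ hδ0))
  obtain ⟨N', hN'⟩ := exists_nat_gt (1 / η)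
  refine eventually_atTop.2 ⟨max (max N N') 1, fun r hr => ?_⟩
  have hrN : N ≤ r := (le_max_left _ _).trans ((le_max_left _ _).trans hr)
  have hrN' : N' ≤ r := (le_max_right _ _).trans ((le_max_left _ _).trans hr)
  have hr1 : 1 ≤ r := (le_max_right _ _).trans hr
  have hr0 : (0 : ℝ) < r := by exact_mod_cast hr1
  have hηr : 1 ≤ η * r := by
    rw [div_lt_iff₀ hη0] at hN'
    have : (N' : ℝ) ≤ r := by exact_mod_cast hrN'
    nlinarith
  obtain ⟨m, hm1, hm2⟩ : ∃ m : ℕ, η * r ≤ m ∧ (m : ℝ) ≤ 2 * (η * r) :=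
    ⟨⌈η * r⌉₊, Nat.le_ceil _, by
      have := Nat.ceil_lt_add_one (by positivity : 0 ≤ η * (r : ℝ))
      linarith⟩
  have hmr : (m : ℝ) ≤ r := by nlinarith
  have hm0 : (0 : ℝ) < m := by linarith
  have hR0 : (0 : ℝ) < ((r + m : ℕ) : ℝ) := by push_cast; linarith
  have h1 := h.surrogateValue_add_le hr1 m
  have h2 := h.noise_add_le_surrogateValue r
  obtain ⟨n1, v1⟩ := hN r hrN
  obtain ⟨n2, v2⟩ := hN (r + m) (by omega)
  have n1 := abs_le.1 (n1 _ (h.mem r))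
  have n2 := abs_le.1 (n2 _ (h.mem r))
  rw [Real.dist_eq, abs_lt] at v1 v2
  have e1 : surrogateValue H x r = surrogateValue H x r / r * r := by field_simp
  have e2 : surrogateValue H x (r + m) = surrogateValue H x (r + m) / (r + m : ℕ) * (r + m : ℕ) := by
    field_simp
  set w := surrogateValue H x r / r
  set w' := surrogateValue H x (r + m) / (r + m : ℕ)
  have h3 : (m : ℝ) ^ 3 / r ^ 2 ≤ m * (4 * η ^ 2) := by
    rw [div_le_iff₀ (by positivity)]
    have : (m : ℝ) ^ 2 ≤ (2 * (η * r)) ^ 2 := by gcongr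
    calc (m : ℝ) ^ 3 = m * m ^ 2 := by ring
      _ ≤ m * (2 * (η * r)) ^ 2 := by gcongr
      _ = _ := by ring
  have h4 : K * ((m : ℝ) ^ 3 / r ^ 2) ≤ K * (m * (4 * η ^ 2)) := by gcongr
  rw [Real.dist_eq, sub_zero, abs_lt]
  constructor
  · have : -δ * r ≤ (w - f (x r)) * r := by nlinarith
    have := le_of_mul_le_mul_right this hr0
    nlinarith
  · have hw : w' ≥ w - 2 * δ := by linarith
    have h5 : (w - 2 * δ) * ((r + m : ℕ) : ℝ) ≤ w' * ((r + m : ℕ) : ℝ) := by gcongr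
    have h6 : m * (w - f (x r)) ≤ 10 * δ * r + m * (4 * K * η ^ 2) - δ * r := by
      push_cast at h5 n2 e2 h1
      have h7 := mul_le_mul_of_nonneg_left hmr hδ0.le
      have h8 : (w - 2 * δ) * (r + m) = w * r + w * m - 2 * (δ * r) - 2 * (δ * m) := by ring
      have h9 : K * (m * (4 * η ^ 2)) = m * (4 * K * η ^ 2) := by ring
      linarith
    have h7 : 10 * δ * r ≤ m * (ε / 2) := by
      have := mul_le_mul_of_nonneg_left hm1 (half_pos hε).le
      have e : 10 * δ * r = ε / 2 * (η * r) := by rw [hδ]; ring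
      linarith
    have h8 : m * (w - f (x r)) < m * ε := by
      have := mul_lt_mul_of_pos_left hηK hm0
      linarith [mul_pos hδ0 hr0]
    exact lt_of_mul_lt_mul_left h8 hm0.le

/-- Growth of problem r at x_R bounds the left side by the excess of the first r surrogates at x_R
over W_r. That excess is at most W_R - W_r - (R - r) f(x_R) up to noise, and this is small relative
to R since W_R / R, W_r / r and f(x_R) are all close to one limit. -/
lemma eventually_mul_norm_sub_sq_le (h : IsMajorizationRun X f G H x M L γ C D C₀) {η : ℝ}
    (hη : 0 < η) : ∃ N : ℕ, ∀ r R : ℕ, N ≤ r → r ≤ R → r * ‖x R - x r‖ ^ 2 ≤ η * R := by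
  obtain ⟨v, hv⟩ := h.exists_tendsto_average
  have hγ := h.γ_pos
  set δ := η * γ / 20 with hδ
  have hδ0 : 0 < δ := by positivity
  obtain ⟨N, hN⟩ := eventually_atTop.1 ((h.eventually_abs_noise_le hδ0).and
    ((Metric.tendsto_nhds.1 hv δ hδ0).and (Metric.tendsto_nhds.1 h.tendsto_average_sub δ hδ0)))
  refine ⟨N + 1, fun r R hr hR => ?_⟩
  obtain ⟨n1, v1, -⟩ := hN r (by omega)
  obtain ⟨n2, v2, w2⟩ := hN R (by omega)
  have n1 := abs_le.1 (n1 _ (h.mem R))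
  have n2 := abs_le.1 (n2 _ (h.mem R))
  rw [Real.dist_eq, abs_lt] at v1 v2 w2
  have hr0 : (0 : ℝ) < r := by exact_mod_cast (by omega : 0 < r)
  have hR0 : (0 : ℝ) < R := by exact_mod_cast (by omega : 0 < R)
  have hrR : (r : ℝ) ≤ R := by exact_mod_cast hR
  have h1 := h.growth r (x R) (h.mem R)
  have e1 : surrogateValue H x r = surrogateValue H x r / r * r := by field_simp
  have e2 : surrogateValue H x R = surrogateValue H x R / R * R := by field_simp
  have h2 : ∑ i ∈ Finset.range r, H i (x R) + (noise f G R (x R) - noise f G r (x R))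
      + (R - r) * f (x R) ≤ surrogateValue H x R := by
    obtain ⟨m, rfl⟩ := Nat.exists_eq_add_of_le hR
    unfold noise surrogateValue
    rw [Finset.sum_range_add, Finset.sum_range_add, Finset.sum_sub_distrib (f := fun i => G (r + i) _),
      Finset.sum_const, Finset.card_range, nsmul_eq_mul]
    have := Finset.sum_le_sum fun i (_ : i ∈ Finset.range m) =>
      h.le_surrogate (r + i) (x (r + m)) (h.mem _)
    push_cast
    linarith
  set w := surrogateValue H x r / r
  set w' := surrogateValue H x R / R
  have h3 : r * (γ / 2) * ‖x R - x r‖ ^ 2 ≤ w' * R - w * r - (R - r) * f (x R) + 2 * δ * R := by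
    nlinarith
  have hd : 0 ≤ (R : ℝ) - r := by linarith
  have h4 : w' * R - w * r - (R - r) * f (x R) ≤ 8 * δ * R := by
    have a1 : (v - δ) * r ≤ w * r := by gcongr; linarith
    have a2 : w' * R ≤ (v + δ) * R := by gcongr; linarith
    have a3 : (R - r) * (v - 2 * δ) ≤ (R - r) * f (x R) := by gcongr; linarith
    nlinarith
  have h5 : γ / 2 * (r * ‖x R - x r‖ ^ 2) ≤ γ / 2 * (η * R) := by
    have : 10 * δ * R = γ / 2 * (η * R) := by rw [hδ]; ring
    linarith
  exact le_of_mul_le_mul_left h5 (by positivity)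

/-- The few indices below κR cost at most D² each. For i ≥ κR the previous lemma, divided by i,
leaves at most ε / 2 per term. -/
lemma eventually_sum_norm_sub_sq_le (h : IsMajorizationRun X f G H x M L γ C D C₀) {ε : ℝ}
    (hε : 0 < ε) :
    ∀ᶠ R : ℕ in atTop, ∑ i ∈ Finset.range R, ‖x R - x i‖ ^ 2 ≤ ε * R := by
  set κ := ε / (4 * (D ^ 2 + 1)) with hκ
  have hκ0 : 0 < κ := by positivity
  obtain ⟨N, hN⟩ := h.eventually_mul_norm_sub_sq_le (by positivity : 0 < ε / 2 * κ)
  obtain ⟨N', hN'⟩ := exists_nat_gt (((N : ℝ) + 1) / κ)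
  filter_upwards [eventually_ge_atTop (N' + 1)] with R hR
  have hR0 : (0 : ℝ) < R := by exact_mod_cast (by omega : 0 < R)
  have hNR : (N : ℝ) + 1 ≤ κ * R := by
    rw [div_lt_iff₀ hκ0] at hN'
    have : (N' : ℝ) ≤ R := by exact_mod_cast (by omega : N' ≤ R)
    nlinarith
  have hterm : ∀ i ∈ Finset.range R,
      ‖x R - x i‖ ^ 2 ≤ (if i < ⌈κ * R⌉₊ then D ^ 2 else 0) + ε / 2 := by
    intro i hi
    split_ifs with hc
    · have : ‖x R - x i‖ ^ 2 ≤ D ^ 2 := by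
        gcongr
        exact h.diam _ (h.mem _) _ (h.mem _)
      linarith
    · have hi1 : κ * R ≤ i := Nat.ceil_le.1 (not_lt.1 hc)
      have hi0 : (0 : ℝ) < i := by linarith [Nat.cast_nonneg (α := ℝ) N]
      have hNi : N ≤ i := by
        have : (N : ℝ) ≤ i := by linarith
        exact_mod_cast this
      have h1 := hN i R hNi (Finset.mem_range.1 hi).le
      rw [zero_add]
      refine le_of_mul_le_mul_left (h1.trans ?_) hi0
      nlinarith
  refine (Finset.sum_le_sum hterm).trans ?_
  rw [Finset.sum_add_distrib, Finset.sum_const, Finset.card_range, nsmul_eq_mul, ← Finset.sum_filter,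
    Finset.sum_const, nsmul_eq_mul]
  have hcard : (((Finset.range R).filter (· < ⌈κ * R⌉₊)).card : ℝ) ≤ 2 * (κ * R) := by
    have h1 : ((Finset.range R).filter (· < ⌈κ * R⌉₊)).card ≤ ⌈κ * R⌉₊ := by
      refine (Finset.card_le_card (t := Finset.range ⌈κ * R⌉₊) fun i hi => ?_).trans (by simp)
      simpa using (Finset.mem_filter.1 hi).2
    have h2 : (((Finset.range R).filter (· < ⌈κ * R⌉₊)).card : ℝ) ≤ ⌈κ * R⌉₊ := by exact_mod_cast h1
    have h3 := Nat.ceil_lt_add_one (by positivity : 0 ≤ κ * (R : ℝ))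
    linarith [Nat.cast_nonneg (α := ℝ) N]
  have h4 := mul_le_mul_of_nonneg_right hcard (sq_nonneg D)
  have h5 : 2 * (κ * R) * D ^ 2 ≤ ε / 2 * R := by
    have : κ * (4 * (D ^ 2 + 1)) = ε := by rw [hκ]; field_simp
    nlinarith [mul_pos hκ0 hR0]
  linarith

/-- The iterates are asymptotically minimizers of `f` up to a quadratic term. -/
lemma eventually_le_add (h : IsMajorizationRun X f G H x M L γ C D C₀) {ε : ℝ} (hε : 0 < ε) :
    ∀ᶠ R : ℕ in atTop, ∀ u ∈ X, f (x R) ≤ f u + 2 * C * ‖u - x R‖ ^ 2 + ε := by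
  have hC := h.C_nonneg
  have hγ := h.γ_pos
  filter_upwards [h.eventually_abs_noise_le (by positivity : 0 < ε / 4),
    h.eventually_sum_norm_sub_sq_le (by positivity : 0 < ε / (4 * (C + 1))),
    eventually_ge_atTop 1] with R h1 h2 hR u hu
  have hR0 : (0 : ℝ) < R := by exact_mod_cast hR
  have g := h.growth R u hu
  have g0 : 0 ≤ R * (γ / 2) * ‖u - x R‖ ^ 2 := by positivity
  have l := h.noise_add_le_surrogateValue R
  have n1 := abs_le.1 (h1 u hu)
  have n2 := abs_le.1 (h1 _ (h.mem R))
  have s : ∑ i ∈ Finset.range R, H i u ≤ ∑ i ∈ Finset.range R,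
      ((G i u - f u) + (f u + 2 * C * ‖u - x R‖ ^ 2) + 2 * C * ‖x R - x i‖ ^ 2) := by
    refine Finset.sum_le_sum fun i _ => ?_
    have a := h.surrogate_le i u hu
    have b : ‖u - x i‖ ≤ ‖u - x R‖ + ‖x R - x i‖ := norm_sub_le_norm_sub_add_norm_sub _ _ _
    have c : ‖u - x i‖ ^ 2 ≤ 2 * ‖u - x R‖ ^ 2 + 2 * ‖x R - x i‖ ^ 2 := by
      nlinarith [norm_nonneg (u - x i), sq_nonneg (‖u - x R‖ - ‖x R - x i‖)]
    nlinarith [mul_le_mul_of_nonneg_left c hC]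
  rw [Finset.sum_add_distrib, Finset.sum_add_distrib, Finset.sum_const, Finset.card_range,
    nsmul_eq_mul, ← Finset.mul_sum] at s
  have q : 2 * C * ∑ i ∈ Finset.range R, ‖x R - x i‖ ^ 2 ≤ ε / 2 * R := by
    have q1 := mul_le_mul_of_nonneg_left h2 (by positivity : 0 ≤ 2 * C)
    have q2 : 2 * C * (ε / (4 * (C + 1)) * R) ≤ ε / 2 * R := by
      have : ε / 2 * R = 2 * (C + 1) * (ε / (4 * (C + 1)) * R) := by field_simp; ring
      rw [this]
      gcongr
      linarith
    exact q1.trans q2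
  have e : noise f G R u = ∑ i ∈ Finset.range R, (G i u - f u) := rfl
  have fin : f (x R) * R ≤ (f u + 2 * C * ‖u - x R‖ ^ 2 + ε) * R := by
    rw [← e] at s
    nlinarith
  exact le_of_mul_le_mul_right fin hR0

end IsMajorizationRun

/-! ### Directional derivatives, convexity and quadratic bounds. -/

lemma dirDeriv_eq_of_tendsto {n : ℕ} {X : Set (EuclideanSpace ℝ (Fin n))}
    {h : EuclideanSpace ℝ (Fin n) → ℝ} {x d : EuclideanSpace ℝ (Fin n)} (hd : x + d ∈ X) {c : ℝ}
    (hc : Tendsto (fun t : ℝ => (h (x + t • d) - h x) / t) (𝓝[>] 0) (𝓝 c)) :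
    dirDeriv X h x d = c := by
  rw [dirDeriv, if_pos ⟨1, one_pos, by simpa using hd⟩]
  exact ((continuous_coe_real_ereal.tendsto c).comp hc).liminf_eq

lemma add_smul_mem_of_convex {E : Type*} [NormedAddCommGroup E] [NormedSpace ℝ E] {X : Set E}
    (hX : Convex ℝ X) {x d : E} (hx : x ∈ X) (hd : x + d ∈ X) {t : ℝ} (h0 : 0 ≤ t) (h1 : t ≤ 1) :
    x + t • d ∈ X :=
  hX.add_smul_mem hx hd ⟨h0, h1⟩

lemma slope_le_slope_of_convexOn {E : Type*} [NormedAddCommGroup E] [NormedSpace ℝ E] {X : Set E}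
    {h : E → ℝ} (hh : ConvexOn ℝ X h) {x d : E} (hx : x ∈ X) {s t : ℝ} (hs : 0 < s)
    (hst : s ≤ t) (ht : x + t • d ∈ X) :
    (h (x + s • d) - h x) / s ≤ (h (x + t • d) - h x) / t := by
  have ht0 : 0 < t := hs.trans_le hst
  have h1 := hh.2 hx ht (sub_nonneg.2 ((div_le_one ht0).2 hst)) (by positivity : 0 ≤ s / t)
    (by ring)
  have e : (1 - s / t) • x + (s / t) • (x + t • d) = x + s • d := by
    rw [smul_add, smul_smul, div_mul_cancel₀ _ ht0.ne', sub_smul, one_smul]; abel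
  rw [e, smul_eq_mul, smul_eq_mul] at h1
  rw [div_le_div_iff₀ hs ht0]
  have h2 := mul_le_mul_of_nonneg_right h1 ht0.le
  have h3 : ((1 - s / t) * h x + s / t * h (x + t • d)) * t = (t - s) * h x + s * h (x + t • d) := by
    field_simp
  linarith

/-- A convex function whose lower directional derivative is bounded below has a directional
derivative. -/
lemma exists_tendsto_slope_of_convexOn {n : ℕ} {X : Set (EuclideanSpace ℝ (Fin n))}
    {h : EuclideanSpace ℝ (Fin n) → ℝ} (hh : ConvexOn ℝ X h) {x d : EuclideanSpace ℝ (Fin n)}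
    (hx : x ∈ X) (hd : x + d ∈ X) {b : ℝ} (hb : (b : EReal) ≤ dirDeriv X h x d) :
    ∃ c, Tendsto (fun t : ℝ => (h (x + t • d) - h x) / t) (𝓝[>] 0) (𝓝 c) ∧
      b ≤ h (x + d) - h x := by
  have hmem : ∀ t ∈ Set.Ioc (0 : ℝ) 1, x + t • d ∈ X := fun t ht =>
    add_smul_mem_of_convex hh.1 hx hd ht.1.le ht.2
  have hle : ∀ t ∈ Set.Ioc (0 : ℝ) 1, b ≤ (h (x + t • d) - h x) / t := by
    intro t ht
    rw [dirDeriv, if_pos ⟨1, one_pos, by simpa using hd⟩] at hb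
    have h1 : limsup (fun t : ℝ => (((h (x + t • d) - h x) / t : ℝ) : EReal)) (𝓝[>] (0 : ℝ))
        ≤ (((h (x + t • d) - h x) / t : ℝ) : EReal) := by
      refine limsup_le_of_le (by isBoundedDefault) ?_
      filter_upwards [Ioc_mem_nhdsGT ht.1] with s hs
      exact EReal.coe_le_coe_iff.2 (slope_le_slope_of_convexOn hh hx hs.1 hs.2 (hmem t ht))
    exact EReal.coe_le_coe_iff.1 (hb.trans ((liminf_le_limsup).trans h1))
  have hmono : MonotoneOn (fun t : ℝ => (h (x + t • d) - h x) / t) (Set.Ioo 0 1) :=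
    fun s hs t ht hst => slope_le_slope_of_convexOn hh hx hs.1 hst (hmem t ⟨ht.1, ht.2.le⟩)
  refine ⟨_, hmono.tendsto_nhdsWithin_Ioo_right (by simp) ⟨b, ?_⟩, ?_⟩
  · rintro _ ⟨t, ht, rfl⟩
    exact hle t ⟨ht.1, ht.2.le⟩
  · simpa using hle 1 ⟨one_pos, le_rfl⟩

/-- Lower bounds suffice: a convex function lies above its directional linearization, and exchanging
the two points gives the other inequality. -/
lemma abs_sub_le_of_dirDeriv_bound {n : ℕ} {X : Set (EuclideanSpace ℝ (Fin n))}
    {h : EuclideanSpace ℝ (Fin n) → ℝ} (hh : ConvexOn ℝ X h) {K : ℝ}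
    (hK : ∀ x ∈ X, ∀ d, x + d ∈ X → ((-(K * ‖d‖) : ℝ) : EReal) ≤ dirDeriv X h x d)
    {u w : EuclideanSpace ℝ (Fin n)} (hu : u ∈ X) (hw : w ∈ X) :
    |h u - h w| ≤ K * ‖u - w‖ := by
  have key : ∀ u ∈ X, ∀ w ∈ X, -(K * ‖u - w‖) ≤ h u - h w := by
    intro u hu w hw
    have hd : w + (u - w) ∈ X := by simpa using hu
    obtain ⟨c, -, hc⟩ := exists_tendsto_slope_of_convexOn hh hw hd (hK w hw _ hd)
    simpa using hc
  have h1 := key u hu w hw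
  have h2 := key w hw u hu
  rw [norm_sub_rev] at h2
  exact abs_le.2 ⟨h1, by linarith⟩

lemma tendsto_slope_of_differentiableAt {E : Type*} [NormedAddCommGroup E] [NormedSpace ℝ E]
    {h : E → ℝ} {x : E} (hh : DifferentiableAt ℝ h x) (d : E) :
    Tendsto (fun t : ℝ => (h (x + t • d) - h x) / t) (𝓝[>] 0) (𝓝 (fderiv ℝ h x d)) := by
  have := (hh.hasFDerivAt.hasLineDerivAt d).tendsto_slope_zero_right
  refine this.congr fun t => ?_
  rw [smul_eq_mul, div_eq_inv_mul]

/-- A sum of functions with strongly convex first-order lower bounds grows quadratically around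
its minimizers. -/
lemma IsMinOn.sum_add_mul_norm_sq_le {E ι : Type*} [NormedAddCommGroup E] [NormedSpace ℝ E]
    {X : Set E} (hX : Convex ℝ X) {s : Finset ι} {H : ι → E → ℝ} {γ : ℝ} {x d : E} (hx : x ∈ X)
    (hd : x + d ∈ X) (hmin : IsMinOn (fun u => ∑ i ∈ s, H i u) X x) {c : ι → ℝ}
    (hc : ∀ i ∈ s, Tendsto (fun t : ℝ => (H i (x + t • d) - H i x) / t) (𝓝[>] 0) (𝓝 (c i)))
    (hle : ∀ i ∈ s, c i + γ ≤ H i (x + d) - H i x) :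
    ∑ i ∈ s, H i x + s.card * γ ≤ ∑ i ∈ s, H i (x + d) := by
  -- Genuine limits are needed here, since lower limits do not add up in this direction.
  have h1 : 0 ≤ ∑ i ∈ s, c i := by
    refine ge_of_tendsto (tendsto_finsetSum s hc) ?_
    filter_upwards [Ioc_mem_nhdsGT one_pos] with t ht
    rw [← Finset.sum_div, Finset.sum_sub_distrib]
    exact div_nonneg (sub_nonneg.2 (hmin (add_smul_mem_of_convex hX hx hd ht.1.le ht.2))) ht.1.le
  have h2 := Finset.sum_le_sum hle
  rw [Finset.sum_add_distrib, Finset.sum_sub_distrib, Finset.sum_const, nsmul_eq_mul] at h2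
  linarith

/-- A function that touches another one from above at `y` exceeds it by at most a quadratic term
if the second derivatives are bounded. -/
lemma le_add_mul_norm_sq_of_touching {n : ℕ} {X X' : Set (EuclideanSpace ℝ (Fin n))}
    (hX : Convex ℝ X) (hX' : IsOpen X') (hXX' : X ⊆ X') {p q : EuclideanSpace ℝ (Fin n) → ℝ} {K : ℝ}
    (hp : ∀ u ∈ X, TwiceDifferentiableAt p u) (hq : ∀ u ∈ X, TwiceDifferentiableAt q u)
    (hpK : ∀ u ∈ X, ‖fderiv ℝ (fderiv ℝ p) u‖ ≤ K) (hqK : ∀ u ∈ X, ‖fderiv ℝ (fderiv ℝ q) u‖ ≤ K)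
    (hle : ∀ u ∈ X', p u ≤ q u) {y : EuclideanSpace ℝ (Fin n)} (hy : y ∈ X) (heq : q y = p y)
    {u : EuclideanSpace ℝ (Fin n)} (hu : u ∈ X) :
    q u ≤ p u + 2 * K * ‖u - y‖ ^ 2 := by
  have hpd : ∀ w ∈ X, DifferentiableAt ℝ p w := fun w hw => (hp w hw).1.self_of_nhds
  have hqd : ∀ w ∈ X, DifferentiableAt ℝ q w := fun w hw => (hq w hw).1.self_of_nhds
  -- The upper bound holds on an open set, so `q - p` has an unconstrained local minimum at `y`,
  -- even when `y` is on the boundary of `X`.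
  have hzero : fderiv ℝ (fun w => q w - p w) y = 0 := by
    refine IsLocalMin.fderiv_eq_zero ?_
    filter_upwards [hX'.mem_nhds (hXX' hy)] with w hw
    simp only [heq, sub_self]
    exact sub_nonneg.2 (hle w hw)
  rw [fderiv_fun_sub (hqd y hy) (hpd y hy), sub_eq_zero] at hzero
  have hK : 0 ≤ K := (ContinuousLinearMap.opNorm_nonneg _).trans (hpK y hy)
  -- On this convex piece the gradient of `q - p` is bounded by 2K‖u - y‖, so the mean value
  -- inequality gives a quadratic bound.
  set Y := X ∩ Metric.closedBall y ‖u - y‖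
  have hY : Convex ℝ Y := hX.inter (convex_closedBall _ _)
  have hbound : ∀ w ∈ Y, ‖fderiv ℝ (fun w => q w - p w) w‖ ≤ 2 * K * ‖u - y‖ := by
    intro w hw
    rw [fderiv_fun_sub (hqd w hw.1) (hpd w hw.1)]
    have h1 := hX.norm_image_sub_le_of_norm_fderiv_le (fun w hw => (hp w hw).2) hpK hy hw.1
    have h2 := hX.norm_image_sub_le_of_norm_fderiv_le (fun w hw => (hq w hw).2) hqK hy hw.1
    have h3 : ‖w - y‖ ≤ ‖u - y‖ := by simpa [dist_eq_norm] using hw.2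
    have h4 : K * ‖w - y‖ ≤ K * ‖u - y‖ := by gcongr
    have e : fderiv ℝ q w - fderiv ℝ p w
        = (fderiv ℝ q w - fderiv ℝ q y) - (fderiv ℝ p w - fderiv ℝ p y) := by
      rw [hzero]; abel
    rw [e]
    exact (norm_sub_le _ _).trans (by linarith)
  have h5 := hY.norm_image_sub_le_of_norm_fderiv_le
    (fun w hw => (hqd w hw.1).fun_sub (hpd w hw.1)) hbound (x := y) (y := u)
    ⟨hy, by simp⟩ ⟨hu, by simp [dist_eq_norm]⟩
  rw [heq, sub_self, sub_zero, Real.norm_eq_abs] at h5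
  nlinarith [le_abs_self (q u - p u)]

/-! ### From approximate minimality to stationarity. -/

/-- A point at which `f` is minimal on `X` up to a quadratic term is stationary. -/
lemma mem_stationaryPoints_of_le_add {n : ℕ} {X : Set (EuclideanSpace ℝ (Fin n))}
    (hX : Convex ℝ X) {f : EuclideanSpace ℝ (Fin n) → ℝ} {C : ℝ} {x : EuclideanSpace ℝ (Fin n)}
    (hx : x ∈ X) (h : ∀ u ∈ X, f x ≤ f u + C * ‖u - x‖ ^ 2) : x ∈ stationaryPoints X f := by
  refine ⟨hx, fun d => ?_⟩
  rw [dirDeriv]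
  split_ifs with hd
  · obtain ⟨s, hs, hsX⟩ := hd
    have hlim : Tendsto (fun t : ℝ => ((-(C * ‖d‖ ^ 2 * t) : ℝ) : EReal)) (𝓝[>] 0) (𝓝 (0 : ℝ)) := by
      refine (continuous_coe_real_ereal.tendsto 0).comp (tendsto_nhdsWithin_of_tendsto_nhds ?_)
      have : Continuous fun t : ℝ => -(C * ‖d‖ ^ 2 * t) := by fun_prop
      simpa using this.tendsto 0
    rw [← EReal.coe_zero, ← hlim.liminf_eq]
    refine liminf_le_liminf ?_
    filter_upwards [Ioc_mem_nhdsGT hs] with t ht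
    refine EReal.coe_le_coe_iff.2 ?_
    have hmem : x + t • d ∈ X := by
      have := add_smul_mem_of_convex hX hx hsX (t := t / s) (div_nonneg ht.1.le hs.le)
        ((div_le_one hs).2 ht.2)
      rwa [smul_smul, div_mul_cancel₀ _ hs.ne'] at this
    have h1 := h _ hmem
    rw [add_sub_cancel_left, norm_smul, Real.norm_of_nonneg ht.1.le] at h1
    rw [le_div_iff₀ ht.1]
    nlinarith
  · exact le_top

/-- Asymptotic minimality up to a quadratic term along a sequence in a compact set forces
convergence to the stationary points. -/
lemma tendsto_infDist_stationaryPoints {n : ℕ} {X : Set (EuclideanSpace ℝ (Fin n))}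
    (hXc : IsCompact X) (hX : Convex ℝ X) {f : EuclideanSpace ℝ (Fin n) → ℝ}
    (hf : ContinuousOn f X) {C : ℝ} {x : ℕ → EuclideanSpace ℝ (Fin n)} (hx : ∀ r, x r ∈ X)
    (h : ∀ ε > 0, ∀ᶠ r in atTop, ∀ u ∈ X, f (x r) ≤ f u + C * ‖u - x r‖ ^ 2 + ε) :
    (stationaryPoints X f).Nonempty ∧
      Tendsto (fun r => Metric.infDist (x r) (stationaryPoints X f)) atTop (𝓝 0) := by
  have key : ∀ φ : ℕ → ℕ, Tendsto φ atTop atTop →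
      ∃ y ∈ stationaryPoints X f, ∃ ψ : ℕ → ℕ, Tendsto (x ∘ φ ∘ ψ) atTop (𝓝 y) := by
    intro φ hφ
    obtain ⟨y, hy, ψ, hψ, hlim⟩ := hXc.tendsto_subseq fun r => hx (φ r)
    refine ⟨y, mem_stationaryPoints_of_le_add hX (C := C) hy fun u hu => ?_, ψ, hlim⟩
    refine le_of_forall_pos_le_add fun ε hε => ?_
    have h1 : Tendsto (fun k => f (x (φ (ψ k)))) atTop (𝓝 (f y)) :=
      (hf y hy).tendsto.comp (tendsto_nhdsWithin_iff.2 ⟨hlim, .of_forall fun k => hx _⟩)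
    have h2 : Tendsto (fun k => f u + C * ‖u - x (φ (ψ k))‖ ^ 2 + ε) atTop
        (𝓝 (f u + C * ‖u - y‖ ^ 2 + ε)) := by
      have hlim' : Tendsto (fun k => x (φ (ψ k))) atTop (𝓝 y) := hlim
      exact (((((tendsto_const_nhds (x := u)).sub hlim').norm.pow 2).const_mul C).const_add
        (f u)).add_const ε
    refine le_of_tendsto_of_tendsto h1 h2 ?_
    filter_upwards [(hφ.comp hψ.tendsto_atTop).eventually (h ε hε)] with k hk using hk u hu
  refine ⟨?_, ?_⟩
  · obtain ⟨y, hy, -⟩ := key id tendsto_id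
    exact ⟨y, hy⟩
  · refine tendsto_of_subseq_tendsto fun φ hφ => ?_
    obtain ⟨y, hy, ψ, hψ⟩ := key φ hφ
    refine ⟨ψ, ?_⟩
    have := (Metric.continuous_infDist_pt (stationaryPoints X f)).continuousAt (x := y)
    have h3 := this.tendsto.comp hψ
    rwa [Metric.infDist_zero_of_mem hy] at h3

/-! ### Uniform law of large numbers. -/

/-- Bounded subsets of Euclidean space have nets of polynomial size. -/
lemma exists_finset_net {n : ℕ} {X : Set (EuclideanSpace ℝ (Fin n))} (hX : Bornology.IsBounded X) :
    ∃ A : ℕ, ∀ m : ℕ, 1 ≤ m → ∃ N : Finset (EuclideanSpace ℝ (Fin n)), (N : Set _) ⊆ X ∧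
      N.card ≤ (A * m) ^ n ∧ ∀ x ∈ X, ∃ y ∈ N, ‖x - y‖ ≤ 1 / m := by
  classical
  obtain ⟨ρ, hρ⟩ := hX.exists_norm_le
  obtain ⟨Q, hQ⟩ := exists_nat_gt ρ
  refine ⟨(2 * Q + 3) * (n + 1), fun m hm => ?_⟩
  -- Cells of side 1 / k have diameter at most √n / k ≤ 1 / m.
  set k : ℕ := (n + 1) * m with hk
  have hm0 : (0 : ℝ) < m := by exact_mod_cast hm
  have hk1 : 1 ≤ k := Nat.mul_pos n.succ_pos hm
  have hk0 : (0 : ℝ) < k := by exact_mod_cast hk1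
  let cell : EuclideanSpace ℝ (Fin n) → Fin n → ℤ := fun x i => ⌊x i * k⌋
  let S : Finset (Fin n → ℤ) :=
    Fintype.piFinset fun _ => Finset.Icc (-(Q * k + 1 : ℤ)) (Q * k + 1 : ℤ)
  have hcell : ∀ x ∈ X, cell x ∈ S := by
    intro x hx
    refine Fintype.mem_piFinset.2 fun i => ?_
    have h1 : |x i| ≤ Q := by
      have := (PiLp.norm_apply_le x i).trans (hρ x hx)
      rw [Real.norm_eq_abs] at this
      linarith
    obtain ⟨h1, h2⟩ := abs_le.1 h1
    rw [Finset.mem_Icc]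
    constructor
    · refine Int.le_floor.2 ?_
      push_cast
      nlinarith
    · have : (⌊x i * k⌋ : ℝ) ≤ ((Q * k + 1 : ℤ) : ℝ) := by
        refine (Int.floor_le _).trans ?_
        push_cast
        nlinarith
      exact_mod_cast this
  have hcard : S.card ≤ ((2 * Q + 3) * (n + 1) * m) ^ n := by
    rw [Fintype.card_piFinset, Finset.prod_const, Finset.card_univ, Fintype.card_fin]
    refine Nat.pow_le_pow_left ?_ n
    rw [Int.card_Icc, mul_assoc, ← hk]
    have : (Q * k + 1 + 1 - -(Q * k + 1) : ℤ) = ((2 * (Q * k) + 3 : ℕ) : ℤ) := by push_cast; ring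
    rw [this, Int.toNat_natCast]
    nlinarith
  -- One point of `X` is chosen in each occupied cell, so that the net lies in `X`; the default
  -- value 0 is filtered out below unless it belongs to `X`.
  let rep : (Fin n → ℤ) → EuclideanSpace ℝ (Fin n) := fun c =>
    if h : ∃ x ∈ X, cell x = c then h.choose else 0
  have hrep : ∀ x ∈ X, rep (cell x) ∈ X ∧ cell (rep (cell x)) = cell x := by
    intro x hx
    have h : ∃ y ∈ X, cell y = cell x := ⟨x, hx, rfl⟩
    simp only [rep, dif_pos h]
    exact h.choose_spec
  refine ⟨(S.image rep).filter (· ∈ X), fun y hy => (Finset.mem_filter.1 hy).2,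
    (Finset.card_filter_le _ _).trans (Finset.card_image_le.trans hcard), fun x hx => ?_⟩
  obtain ⟨h1, h2⟩ := hrep x hx
  refine ⟨rep (cell x), Finset.mem_filter.2 ⟨Finset.mem_image_of_mem _ (hcell x hx), h1⟩, ?_⟩
  set y := rep (cell x)
  have hcoord : ∀ i, |(x - y) i| ≤ 1 / k := by
    intro i
    have h3 : ⌊x i * k⌋ = ⌊y i * k⌋ := (congrFun h2 i).symm
    have h4 := Int.abs_sub_lt_one_of_floor_eq_floor h3
    rw [← sub_mul, abs_mul, abs_of_pos hk0] at h4
    rw [le_div_iff₀ hk0]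
    simpa using h4.le
  rw [EuclideanSpace.norm_eq]
  refine Real.sqrt_le_iff.2 ⟨by positivity, ?_⟩
  calc ∑ i, ‖(x - y) i‖ ^ 2 ≤ ∑ _i : Fin n, (1 / (k : ℝ)) ^ 2 := by
        refine Finset.sum_le_sum fun i _ => ?_
        rw [Real.norm_eq_abs]
        have := hcoord i
        gcongr
    _ = n * (1 / ((n + 1) * m)) ^ 2 := by simp [hk]
    _ ≤ (1 / m) ^ 2 := by
        rw [one_div_pow, one_div_pow, mul_pow, mul_one_div]
        refine (div_le_div_iff₀ (by positivity) (by positivity)).2 ?_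
        have : (n : ℝ) ≤ (n + 1) ^ 2 := by nlinarith [Nat.cast_nonneg (α := ℝ) n]
        nlinarith [sq_nonneg (m : ℝ)]

section

variable {Ω : Type*} [MeasurableSpace Ω] {μ : Measure Ω} [IsProbabilityMeasure μ]

/-- Two-sided Hoeffding inequality for bounded centred variables. -/
lemma measureReal_le_abs_sum_le {Y : ℕ → Ω → ℝ} {M : ℝ} (hM : 0 < M) (hY : ∀ i, Measurable (Y i))
    (hYM : ∀ i ω, |Y i ω| ≤ M) (hY0 : ∀ i, ∫ ω, Y i ω ∂μ = 0) (hind : iIndepFun Y μ) (r : ℕ)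
    {t : ℝ} (ht : 0 ≤ t) :
    μ.real {ω | t ≤ |∑ i ∈ Finset.range r, Y i ω|} ≤ 2 * Real.exp (-t ^ 2 / (2 * r * M ^ 2)) := by
  have hc : (((‖M - -M‖₊ / 2) ^ 2 : NNReal) : ℝ) = M ^ 2 := by
    push_cast
    rw [Real.norm_of_nonneg (by linarith)]
    ring
  have one_side : ∀ Z : ℕ → Ω → ℝ, (∀ i, Measurable (Z i)) → (∀ i ω, |Z i ω| ≤ M) →
      (∀ i, ∫ ω, Z i ω ∂μ = 0) → iIndepFun Z μ →
      μ.real {ω | t ≤ ∑ i ∈ Finset.range r, Z i ω} ≤ Real.exp (-t ^ 2 / (2 * r * M ^ 2)) := by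
    intro Z hZ hZM hZ0 hZi
    have := HasSubgaussianMGF.measure_sum_range_ge_le_of_iIndepFun hZi (n := r)
      (fun i _ => hasSubgaussianMGF_of_mem_Icc_of_integral_eq_zero (hZ i).aemeasurable
        (.of_forall fun ω => abs_le.1 (hZM i ω)) (hZ0 i)) ht
    rwa [hc] at this
  have h1 := one_side Y hY hYM hY0 hind
  have h2 := one_side (fun i ω => -Y i ω) (fun i => (hY i).neg) (fun i ω => by simpa using hYM i ω)
    (fun i => by rw [integral_neg, hY0, neg_zero])
    (hind.comp (fun _ z => -z) fun _ => measurable_neg)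
  have hsub : {ω | t ≤ |∑ i ∈ Finset.range r, Y i ω|} ⊆
      {ω | t ≤ ∑ i ∈ Finset.range r, Y i ω} ∪ {ω | t ≤ ∑ i ∈ Finset.range r, -Y i ω} := by
    intro ω hω
    rw [Set.mem_union, Set.mem_ofPred_eq, Set.mem_ofPred_eq, Finset.sum_neg_distrib]
    exact le_abs.1 hω
  refine (measureReal_mono hsub).trans ((measureReal_union_le _ _).trans ?_)
  linarith

/-- A uniform strong law of large numbers with a polynomial rate along the fifth powers, for
independent bounded centred functions that are Lipschitz on a bounded set. -/
lemma ae_eventually_abs_sum_le {n : ℕ} {X : Set (EuclideanSpace ℝ (Fin n))}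
    (hX : Bornology.IsBounded X) {Y : ℕ → EuclideanSpace ℝ (Fin n) → Ω → ℝ} {M L : ℝ}
    (hM : 0 < M) (hL : 0 ≤ L) (hY : ∀ i, ∀ u ∈ X, Measurable (Y i u))
    (hYM : ∀ i, ∀ u ∈ X, ∀ ω, |Y i u ω| ≤ M) (hY0 : ∀ i, ∀ u ∈ X, ∫ ω, Y i u ω ∂μ = 0)
    (hind : ∀ u ∈ X, iIndepFun (fun i => Y i u) μ)
    (hYL : ∀ i, ∀ u ∈ X, ∀ w ∈ X, ∀ ω, |Y i u ω - Y i w ω| ≤ L * ‖u - w‖) :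
    ∀ᵐ ω ∂μ, ∀ᶠ j : ℕ in atTop, ∀ u ∈ X,
      |∑ i ∈ Finset.range (j ^ 5), Y i u ω| ≤ (1 + L) * (j : ℝ) ^ 3 := by
  obtain ⟨A, hA⟩ := exists_finset_net hX
  have hA' : ∀ m : ℕ, ∃ N : Finset (EuclideanSpace ℝ (Fin n)), 1 ≤ m → (N : Set _) ⊆ X ∧
      N.card ≤ (A * m) ^ n ∧ ∀ x ∈ X, ∃ y ∈ N, ‖x - y‖ ≤ 1 / m := by
    intro m
    by_cases hm : 1 ≤ m
    · obtain ⟨N, hN⟩ := hA m hm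
      exact ⟨N, fun _ => hN⟩
    · exact ⟨∅, fun h => absurd h hm⟩
  choose N hN using hA'
  -- The bad events for the index j + 1, on a net of mesh (j + 1)^(-2). Passing from the net to `X`
  -- costs L (j + 1)^5 / (j + 1)^2, again of order (j + 1)^3.
  let B : ℕ → Set Ω := fun j => ⋃ y ∈ N ((j + 1) ^ 2),
    {ω | ((j + 1 : ℕ) : ℝ) ^ 3 ≤ |∑ i ∈ Finset.range ((j + 1) ^ 5), Y i y ω|}
  have hB : ∀ j, μ.real (B j) ≤ 2 * (A : ℝ) ^ n *
      (((j + 1 : ℕ) : ℝ) ^ (2 * n) * Real.exp (-(1 / (2 * M ^ 2)) * ((j + 1 : ℕ) : ℝ))) := by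
    intro j
    obtain ⟨hNX, hNc, -⟩ := hN ((j + 1) ^ 2) (Nat.one_le_pow _ _ j.succ_pos)
    have hj : (0 : ℝ) < ((j + 1 : ℕ) : ℝ) := by positivity
    refine (measureReal_biUnion_finset_le _ _).trans ?_
    calc _ ≤ ∑ y ∈ N ((j + 1) ^ 2),
          2 * Real.exp (-(1 / (2 * M ^ 2)) * ((j + 1 : ℕ) : ℝ)) := by
          refine Finset.sum_le_sum fun y hy => ?_
          have hyX := hNX hy
          refine (measureReal_le_abs_sum_le hM (fun i => hY i y hyX) (fun i => hYM i y hyX)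
            (fun i => hY0 i y hyX) (hind y hyX) _ (by positivity)).trans (le_of_eq ?_)
          -- With k = j + 1, the Hoeffding exponent is k^6 / (2 k^5 M²) = k / (2M²).
          congr 2
          push_cast
          field_simp
      _ = (N ((j + 1) ^ 2)).card * (2 * Real.exp (-(1 / (2 * M ^ 2)) * ((j + 1 : ℕ) : ℝ))) := by
          rw [Finset.sum_const, nsmul_eq_mul]
      _ ≤ ((A * (j + 1) ^ 2) ^ n : ℕ) *
            (2 * Real.exp (-(1 / (2 * M ^ 2)) * ((j + 1 : ℕ) : ℝ))) := by
          gcongr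
      _ = _ := by push_cast; rw [mul_pow, ← pow_mul]; ring
  have hsum : Summable fun j => μ.real (B j) := by
    refine Summable.of_nonneg_of_le (fun _ => measureReal_nonneg) hB (Summable.mul_left _ ?_)
    exact (summable_nat_add_iff 1).2
      (Real.summable_pow_mul_exp_neg_nat_mul (2 * n) (by positivity : 0 < 1 / (2 * M ^ 2)))
  have hfin : ∑' j, μ (B j) ≠ ⊤ := by
    have := hsum.tsum_ofReal_ne_top
    simpa using this
  filter_upwards [ae_eventually_notMem hfin] with ω hω
  obtain ⟨J, hJ⟩ := eventually_atTop.1 hω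
  refine eventually_atTop.2 ⟨J + 1, fun j hj u hu => ?_⟩
  obtain ⟨k, rfl⟩ : ∃ k, j = k + 1 := ⟨j - 1, by omega⟩
  obtain ⟨hNX, -, hNd⟩ := hN ((k + 1) ^ 2) (Nat.one_le_pow _ _ k.succ_pos)
  obtain ⟨y, hy, hyd⟩ := hNd u hu
  have h1 := hJ k (by omega)
  simp only [B, Set.mem_iUnion, Set.mem_ofPred_eq, not_exists, not_le] at h1
  have h2 := h1 y hy
  have h3 : |∑ i ∈ Finset.range ((k + 1) ^ 5), Y i u ω
      - ∑ i ∈ Finset.range ((k + 1) ^ 5), Y i y ω| ≤ L * ((k + 1 : ℕ) : ℝ) ^ 3 := by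
    rw [← Finset.sum_sub_distrib]
    refine (Finset.abs_sum_le_sum_abs _ _).trans ?_
    refine (Finset.sum_le_sum fun i _ => (hYL i u hu y (hNX hy) ω).trans
      (mul_le_mul_of_nonneg_left hyd hL)).trans (le_of_eq ?_)
    rw [Finset.sum_const, Finset.card_range, nsmul_eq_mul]
    push_cast
    field_simp
  have h4 := abs_sub_abs_le_abs_sub (∑ i ∈ Finset.range ((k + 1) ^ 5), Y i u ω)
    (∑ i ∈ Finset.range ((k + 1) ^ 5), Y i y ω)
  linarith

end

section

variable {n : ℕ} {Ξ : Type*} [MeasurableSpace Ξ] {P : Measure Ξ} [IsProbabilityMeasure P]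
  {X : Set (EuclideanSpace ℝ (Fin n))} {g₁ g₂ : EuclideanSpace ℝ (Fin n) → Ξ → ℝ} {M L : ℝ}

lemma integrable_of_abs_le {g : Ξ → ℝ} (hg : Measurable g) (hM : ∀ z, |g z| ≤ M) :
    Integrable g P :=
  .of_bound hg.aestronglyMeasurable M (.of_forall hM)

lemma abs_objective_le (hM : ∀ u ∈ X, ∀ z, |g₁ u z + g₂ u z| ≤ M)
    {u : EuclideanSpace ℝ (Fin n)} (hu : u ∈ X) : |objective P g₁ g₂ u| ≤ M := by
  have := norm_integral_le_of_norm_le_const (μ := P)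
    (f := fun z => g₁ u z + g₂ u z) (.of_forall (hM u hu))
  simpa [objective] using this

lemma abs_objective_sub_le (hmeas : ∀ u ∈ X, Measurable fun z => g₁ u z + g₂ u z)
    (hM : ∀ u ∈ X, ∀ z, |g₁ u z + g₂ u z| ≤ M)
    (hL : ∀ u ∈ X, ∀ w ∈ X, ∀ z, |(g₁ u z + g₂ u z) - (g₁ w z + g₂ w z)| ≤ L * ‖u - w‖)
    {u w : EuclideanSpace ℝ (Fin n)} (hu : u ∈ X) (hw : w ∈ X) :
    |objective P g₁ g₂ u - objective P g₁ g₂ w| ≤ L * ‖u - w‖ := by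
  have := norm_integral_le_of_norm_le_const (μ := P)
    (f := fun z => (g₁ u z + g₂ u z) - (g₁ w z + g₂ w z)) (.of_forall (hL u hu w hw))
  rw [integral_sub (integrable_of_abs_le (hmeas u hu) (hM u hu))
    (integrable_of_abs_le (hmeas w hw) (hM w hw))] at this
  simpa [objective] using this

/-- The uniform law of large numbers, with a rate, for the sample averages of the objective. -/
lemma ae_eventually_abs_noise_le {Ω : Type*} [MeasurableSpace Ω] {μ : Measure Ω}
    [IsProbabilityMeasure μ] (hX : Bornology.IsBounded X)
    (hmeas : ∀ u ∈ X, Measurable fun z => g₁ u z + g₂ u z) (hM0 : 0 < M) (hL0 : 0 ≤ L)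
    (hM : ∀ u ∈ X, ∀ z, |g₁ u z + g₂ u z| ≤ M)
    (hL : ∀ u ∈ X, ∀ w ∈ X, ∀ z, |(g₁ u z + g₂ u z) - (g₁ w z + g₂ w z)| ≤ L * ‖u - w‖)
    {ξ : ℕ → Ω → Ξ} (hξ : ∀ i, Measurable (ξ i)) (hlaw : ∀ i, Measure.map (ξ i) μ = P)
    (hind : iIndepFun ξ μ) :
    ∀ᵐ ω ∂μ, ∀ᶠ j : ℕ in atTop, ∀ u ∈ X,
      |noise (objective P g₁ g₂) (fun i u => g₁ u (ξ i ω) + g₂ u (ξ i ω)) (j ^ 5) u|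
        ≤ (1 + 2 * L) * (j : ℝ) ^ 3 := by
  refine ae_eventually_abs_sum_le hX
    (Y := fun i u ω => g₁ u (ξ i ω) + g₂ u (ξ i ω) - objective P g₁ g₂ u)
    (M := 2 * M) (by positivity) (by positivity) (fun i u hu => ?_) (fun i u hu ω => ?_)
    (fun i u hu => ?_) (fun u hu => ?_) (fun i u hu w hw ω => ?_)
  · exact ((hmeas u hu).comp (hξ i)).sub_const _
  · refine (abs_sub _ _).trans ?_
    linarith [hM u hu (ξ i ω), abs_objective_le (P := P) hM hu]
  · have hint : Integrable (fun ω => g₁ u (ξ i ω) + g₂ u (ξ i ω)) μ :=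
      integrable_of_abs_le ((hmeas u hu).comp (hξ i)) fun ω => hM u hu (ξ i ω)
    rw [integral_sub hint (integrable_const _), integral_const, probReal_univ, one_smul, sub_eq_zero, objective,
      ← hlaw i, integral_map (hξ i).aemeasurable (hmeas u hu).aestronglyMeasurable]
  · exact hind.comp (fun _ z => g₁ u z + g₂ u z - objective P g₁ g₂ u)
      fun _ => (hmeas u hu).sub_const _
  · have h1 := hL u hu w hw (ξ i ω)
    have h2 := abs_objective_sub_le (P := P) hmeas hM hL hu hw
    rw [sub_sub_sub_comm]
    refine (abs_sub _ _).trans ?_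
    linarith

end

/-! ### Application to the algorithm. -/

/-- Quadratic growth of the averaged surrogates at the iterates. -/
lemma IsIterates.growth {n : ℕ} {Ξ : Type*} {X : Set (EuclideanSpace ℝ (Fin n))}
    {g₂ : EuclideanSpace ℝ (Fin n) → Ξ → ℝ}
    {ghat₁ : EuclideanSpace ℝ (Fin n) → EuclideanSpace ℝ (Fin n) → Ξ → ℝ} {ξ : ℕ → Ξ}
    {x : ℕ → EuclideanSpace ℝ (Fin n)} (hx : IsIterates X g₂ ghat₁ ξ x) (hX : Convex ℝ X)
    {γ K : ℝ} (hmem : ∀ r, x r ∈ X)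
    (hsc : ∀ x ∈ X, ∀ y ∈ X, ∀ z : Ξ, ∀ d, x + d ∈ X →
      dirDeriv X (fun u => ghat₁ u y z + g₂ u z) x d + ((γ / 2 * ‖d‖ ^ 2 : ℝ) : EReal)
        ≤ (((ghat₁ (x + d) y z + g₂ (x + d) z) - (ghat₁ x y z + g₂ x z) : ℝ) : EReal))
    (hdiff : ∀ x ∈ X, ∀ y ∈ X, ∀ z, DifferentiableAt ℝ (fun u => ghat₁ u y z) x)
    (hg₂ : ∀ z, ConvexOn ℝ X (fun u => g₂ u z))
    (hK : ∀ z, ∀ x ∈ X, ∀ d, x + d ∈ X →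
      ((-(K * ‖d‖) : ℝ) : EReal) ≤ dirDeriv X (fun u => g₂ u z) x d)
    (r : ℕ) {u : EuclideanSpace ℝ (Fin n)} (hu : u ∈ X) :
    surrogateValue (fun i u => ghat₁ u (x i) (ξ i) + g₂ u (ξ i)) x r
      + r * (γ / 2) * ‖u - x r‖ ^ 2
        ≤ ∑ i ∈ Finset.range r, (ghat₁ u (x i) (ξ i) + g₂ u (ξ i)) := by
  rcases Nat.eq_zero_or_pos r with rfl | hr
  · simp [surrogateValue]
  have hr0 : (0 : ℝ) < r := by exact_mod_cast hr
  have hd : x r + (u - x r) ∈ X := by simpa using hu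
  have hmin : IsMinOn (fun u => ∑ i ∈ Finset.range r, (ghat₁ u (x i) (ξ i) + g₂ u (ξ i))) X
      (x r) := fun w hw => le_of_mul_le_mul_left ((hx.2 r hr).2 hw) (by positivity : 0 < 1 / (r : ℝ))
  -- The smooth part is differentiable. The difference quotients of the convex part are monotone and
  -- bounded below, hence converge.
  have hslope : ∀ i, ∃ c, Tendsto (fun t : ℝ =>
      ((ghat₁ (x r + t • (u - x r)) (x i) (ξ i) + g₂ (x r + t • (u - x r)) (ξ i))
        - (ghat₁ (x r) (x i) (ξ i) + g₂ (x r) (ξ i))) / t) (𝓝[>] 0) (𝓝 c) := by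
    intro i
    obtain ⟨c, hc, -⟩ :=
      exists_tendsto_slope_of_convexOn (hg₂ (ξ i)) (hmem r) hd (hK (ξ i) _ (hmem r) _ hd)
    refine ⟨_, ((tendsto_slope_of_differentiableAt
      (hdiff _ (hmem r) _ (hmem i) (ξ i)) (u - x r)).add hc).congr fun t => ?_⟩
    rw [← add_div, add_sub_add_comm]
  choose c hc using hslope
  have h := IsMinOn.sum_add_mul_norm_sq_le (s := Finset.range r)
    (H := fun i u => ghat₁ u (x i) (ξ i) + g₂ u (ξ i)) hX (hmem r) hd hmin (c := c)
    (γ := γ / 2 * ‖u - x r‖ ^ 2) (fun i _ => hc i) (fun i _ => by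
      have h1 := hsc _ (hmem r) _ (hmem i) (ξ i) _ hd
      rw [dirDeriv_eq_of_tendsto (h := fun u => ghat₁ u (x i) (ξ i) + g₂ u (ξ i)) hd (hc i)] at h1
      exact_mod_cast h1)
  rw [Finset.card_range, add_sub_cancel] at h
  unfold surrogateValue
  linarith

end SSUM

theorem theorem1 {n : ℕ} {Ξ Ω : Type*} [MeasurableSpace Ξ] [MeasurableSpace Ω]
    (μ : Measure Ω) [IsProbabilityMeasure μ] (P : Measure Ξ) [IsProbabilityMeasure P]
    (X : Set (EuclideanSpace ℝ (Fin n)))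
    (g₁ g₂ : EuclideanSpace ℝ (Fin n) → Ξ → ℝ)
    (ghat₁ : EuclideanSpace ℝ (Fin n) → EuclideanSpace ℝ (Fin n) → Ξ → ℝ)
    (hS : SSUM.Setting X g₁ g₂)
    (hA : SSUM.SurrogateAssumptions X g₁ g₂ ghat₁)
    (hB : SSUM.BoundednessAssumptions X g₁ g₂ ghat₁)
    (ξ : ℕ → Ω → Ξ) (hξ_meas : ∀ i, Measurable (ξ i))
    (hξ_law : ∀ i, Measure.map (ξ i) μ = P) (hξ_indep : iIndepFun ξ μ)
    (x : ℕ → Ω → EuclideanSpace ℝ (Fin n))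
    (hx : ∀ᵐ ω ∂μ, SSUM.IsIterates X g₂ ghat₁ (fun i => ξ i ω) (fun r => x r ω)) :
    (SSUM.stationaryPoints X (SSUM.objective P g₁ g₂)).Nonempty ∧
    ∀ᵐ ω ∂μ, Tendsto
      (fun r => Metric.infDist (x r ω) (SSUM.stationaryPoints X (SSUM.objective P g₁ g₂)))
      atTop (𝓝 0) := by
  obtain ⟨K, hK0, hK⟩ := hB.bound_smooth
  obtain ⟨K', hK'0, hK'⟩ := hB.bound_nonsmooth
  obtain ⟨γ, hγ0, hγ⟩ := hA.strongly_convex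
  obtain ⟨X', hX'o, hXX', hX'⟩ := hA.upper_bound
  have hXconv := hS.convex
  obtain ⟨D, hD⟩ := Metric.isBounded_iff.1 hB.isBounded
  have hlip₂ : ∀ z, ∀ u ∈ X, ∀ w ∈ X, |g₂ u z - g₂ w z| ≤ K' * ‖u - w‖ := fun z u hu w hw =>
    SSUM.abs_sub_le_of_dirDeriv_bound (hS.convexOn_g₂ z) (fun v hv d hd => ((hK' v hv z).2 d hd).1)
      hu hw
  have hlip₁ : ∀ z, ∀ u ∈ X, ∀ w ∈ X, |g₁ u z - g₁ w z| ≤ K * ‖u - w‖ := fun z u hu w hw =>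
    hXconv.norm_image_sub_le_of_norm_fderiv_le (f := fun u => g₁ u z)
      (fun v hv => (hB.twiceDifferentiable_g₁ v hv z).1.self_of_nhds)
      (fun v hv => (hK v hv v hv z).2.1) hw hu
  have hliphat : ∀ y ∈ X, ∀ z, ∀ u ∈ X, ∀ w ∈ X, |ghat₁ u y z - ghat₁ w y z| ≤ K * ‖u - w‖ :=
    fun y hy z u hu w hw =>
      hXconv.norm_image_sub_le_of_norm_fderiv_le (f := fun u => ghat₁ u y z)
        (fun v hv => (hB.twiceDifferentiable_ghat₁ v hv y hy z).1.self_of_nhds)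
        (fun v hv => (hK v hv y hy z).2.2.2.2.1) hw hu
  have hmeas : ∀ u ∈ X, Measurable fun z => g₁ u z + g₂ u z := fun u hu =>
    (hS.measurable_g₁ u hu).add (hS.measurable_g₂ u hu)
  have hbound : ∀ u ∈ X, ∀ z, |g₁ u z + g₂ u z| ≤ K + K' := fun u hu z =>
    (abs_add_le _ _).trans (add_le_add (hK u hu u hu z).1 (hK' u hu z).1)
  have hlip : ∀ u ∈ X, ∀ w ∈ X, ∀ z,
      |(g₁ u z + g₂ u z) - (g₁ w z + g₂ w z)| ≤ (K + K') * ‖u - w‖ := by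
    intro u hu w hw z
    rw [add_sub_add_comm, add_mul]
    exact (abs_add_le _ _).trans (add_le_add (hlip₁ z u hu w hw) (hlip₂ z u hu w hw))
  have hrate := SSUM.ae_eventually_abs_noise_le hB.isBounded hmeas (by positivity) (by positivity)
    hbound hlip hξ_meas hξ_law hξ_indep
  have hcont : ContinuousOn (SSUM.objective P g₁ g₂) X := by
    refine LipschitzOnWith.continuousOn (K := ⟨K + K', by positivity⟩)
      (LipschitzOnWith.of_dist_le_mul fun u hu w hw => ?_)
    rw [Real.dist_eq, dist_eq_norm]
    exact SSUM.abs_objective_sub_le hmeas hbound hlip hu hw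
  have hcompact : IsCompact X := Metric.isCompact_of_isClosed_isBounded hS.isClosed hB.isBounded
  have key : ∀ᵐ ω ∂μ, (SSUM.stationaryPoints X (SSUM.objective P g₁ g₂)).Nonempty ∧ Tendsto
      (fun r => Metric.infDist (x r ω) (SSUM.stationaryPoints X (SSUM.objective P g₁ g₂)))
      atTop (𝓝 0) := by
    filter_upwards [hrate, hx] with ω hω hxω
    have hmem : ∀ r, x r ω ∈ X := fun r =>
      r.eq_zero_or_pos.elim (fun h => h ▸ hxω.1) fun h => (hxω.2 r h).1
    have hrun : SSUM.IsMajorizationRun X (SSUM.objective P g₁ g₂)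
        (fun i u => g₁ u (ξ i ω) + g₂ u (ξ i ω))
        (fun i u => ghat₁ u (x i ω) (ξ i ω) + g₂ u (ξ i ω)) (fun r => x r ω)
        (K + K') (K + K') γ (2 * K) D (1 + 2 * (K + K')) :=
      { L_nonneg := by positivity
        M_nonneg := by positivity
        γ_pos := hγ0
        C_nonneg := by positivity
        C₀_nonneg := by positivity
        mem := hmem
        diam := fun u hu w hw => by simpa [dist_eq_norm] using hD hu hw
        bound_G := fun i u hu => hbound u hu _
        bound_f := fun u hu => SSUM.abs_objective_le hbound hu
        lipschitz := fun i u hu w hw => by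
          rw [add_sub_add_comm, add_mul]
          exact (abs_add_le _ _).trans
            (add_le_add (hliphat _ (hmem i) _ u hu w hw) (hlip₂ _ u hu w hw))
        le_surrogate := fun i u hu => by
          have := hX' u (hXX' hu) _ (hmem i) (ξ i ω)
          linarith
        surrogate_le := fun i u hu => by
          have := SSUM.le_add_mul_norm_sq_of_touching hXconv hX'o hXX'
            (p := fun u => g₁ u (ξ i ω)) (q := fun u => ghat₁ u (x i ω) (ξ i ω)) (K := K)
            (fun v hv => hB.twiceDifferentiable_g₁ v hv _)
            (fun v hv => hB.twiceDifferentiable_ghat₁ v hv _ (hmem i) _)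
            (fun v hv => (hK v hv v hv _).2.2.1)
            (fun v hv => (hK v hv _ (hmem i) _).2.2.2.2.2)
            (fun v hv => hX' v hv _ (hmem i) _) (hmem i) (hA.tight _ (hmem i) _) hu
          linarith
        growth := fun r u hu => hxω.growth hXconv hmem hγ
          (fun v hv y hy z => (hB.twiceDifferentiable_ghat₁ v hv y hy z).1.self_of_nhds)
          hS.convexOn_g₂ (fun z v hv d hd => ((hK' v hv z).2 d hd).1) r hu
        rate := hω }
    exact SSUM.tendsto_infDist_stationaryPoints hcompact hXconv hcont hmem
      fun ε hε => hrun.eventually_le_add hε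
  -- Non-emptiness does not depend on ω, and an almost sure event of a probability space contains a
  -- point.
  exact ⟨key.exists.elim fun _ h => h.1, key.mono fun _ h => h.2⟩
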